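/- Conventions. Let $k$ be a commutative ring, $A$ and $B$ associative unitary $k$-algebras, $C$ an $A$-coring with comultiplication $\Delta$ and $D$ a $B$-coring. Bimodules are $k$-symmetric. $\mathcal M^{C}$ denotes the category of right $C$-comodules (likewise $\mathcal M^{D}$). If $T$ is a $k$-algebra, $M$ is a right $C$-comodule with a left $T$-action by comodule endomorphisms, and $X$ is a right $T$-module, then $X\otimes_T M$ is the comodule with coaction $X\otimes_T\rho_M$. For a $k$-linear functor $F:\mathcal M^{C}\to\mathcal M^{D}$, the ring $T$ acts on $F(M)$ through $F$, and $$\Upsilon_{X,M}:X\otimes_T F(M)\to F(X\otimes_T M),\qquad x\otimes y\mapsto F(x\otimes -)(y),$$ is the unique morphism of comodules, natural in $X$, which for $X=T$ is the canonical isomorphism $T\otimes_T F(M)\cong F(M)\cong F(T\otimes_T M)$. For a $(C,D)$-bicomodule $M$ with left coaction $\lambda_M$ and a right $C$-comodule $N$, $N\square_C M$ is the kernel of $\omega_{N,M}=\rho_N\otimes_A M-N\otimes_A\lambda_M: N\otimes_A M\to N\otimes_A C\otimes_A M$ in right $B$-modules; when these kernels are preserved by $-\otimes_B D$ and the maps $(N\square_C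 M)\otimes_B D\otimes_B D\to N\otimes_A M\otimes_B D\otimes_B D$ are injective for all $N$, $-\square_C M$ is a functor $\mathcal M^{C}\to\mathcal M^{D}$. The coring $C$ is coseparable if $\Delta$ is a split monomorphism of $C$-bicomodules. Theorem. Let $F:\mathcal M^{C}\to\mathcal M^{D}$ be a $k$-linear functor such that (I) ${}_BD$ is flat and $F$ preserves the kernel of $\rho_N\otimes_A C-N\otimes_A\Delta:N\otimes_A C\to N\otimes_A C\otimes_A C$ for every right $C$-comodule $N$, or (II) $C$ is coseparable and the categories $\mathcal M^{C}$ and $\mathcal M^{D}$ are abelian. Assume that at least one of the following holds: (1) $C_A$ is projective, $F$ preserves coproducts, and $\Upsilon_{N,C}$ and $\Upsilon_{N\otimes_A C,\,C}$ are isomorphisms for all right $C$-comodules $N$ (this is so, for example, if $A$ is semisimple and $F$ preserves coproducts); (2) $C_A$ is flat, $F$ preserves direct limits, and $\Upsilon_{N,C}$ and $\Upsilon_{N\otimes_A C,\,C}$ are isomorphisms for all right $C$-comodules $N$ (this is so, for example, if $A$ is von Neumann regular and $F$ preserves direct limits); (3) $F$ preserves inductive limits, that is, all small colimits (this is so, for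 example, if $F$ has a right adjoint). Then $\Upsilon_{C,C}$ is an isomorphism, $F(C)$ is a $(C,D)$-bicomodule with left coaction $\Upsilon_{C,C}^{-1}\circ F(\Delta)$, the functor $-\square_C F(C):\mathcal M^{C}\to\mathcal M^{D}$ is well defined, and $F$ is naturally isomorphic to $-\square_C F(C)$. -/

import Mathlib

open CategoryTheory CategoryTheory.Limits MulOpposite

universe w u

namespace Corings

/-! Right modules over `A` are modules over `Aᵐᵒᵖ`, so `m · a` is `op a • m`.
Bimodules carry a left action and a right action that commute. -/

section BalancedTensor

/-! ### The tensor product over a noncommutative ring -/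

/-- `M ⊗_A N` for a right `A`-module `M` and a left `A`-module `N`: the quotient of `M ⊗_ℤ N`
by the relations `(m · a) ⊗ n = m ⊗ (a · n)`. -/
def BTensor (A M N : Type*) [Ring A] [AddCommGroup M] [Module Aᵐᵒᵖ M] [AddCommGroup N]
    [Module A N] : Type _ :=
  TensorProduct ℤ M N ⧸ Submodule.span ℤ
    {t : TensorProduct ℤ M N | ∃ (m : M) (a : A) (n : N),
      t = TensorProduct.tmul ℤ (op a • m) n - TensorProduct.tmul ℤ m (a • n)}

namespace BTensor

variable {A M N P : Type*} [Ring A] [AddCommGroup M] [Module Aᵐᵒᵖ M] [AddCommGroup N] [Module A N]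
  [AddCommGroup P]

instance : AddCommGroup (BTensor A M N) :=
  inferInstanceAs (AddCommGroup (TensorProduct ℤ M N ⧸ Submodule.span ℤ
    {t : TensorProduct ℤ M N | ∃ (m : M) (a : A) (n : N),
      t = TensorProduct.tmul ℤ (op a • m) n - TensorProduct.tmul ℤ m (a • n)}))

variable (A) in
/-- The pure tensor `m ⊗ n`. -/
def tmul (m : M) (n : N) : BTensor A M N :=
  Submodule.Quotient.mk (TensorProduct.tmul ℤ m n)

theorem add_tmul (m m' : M) (n : N) : tmul A (m + m') n = tmul A m n + tmul A m' n := by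
  unfold tmul
  rw [TensorProduct.add_tmul]
  rfl

theorem tmul_add (m : M) (n n' : N) : tmul A m (n + n') = tmul A m n + tmul A m n' := by
  unfold tmul
  rw [TensorProduct.tmul_add]
  rfl

theorem smul_tmul (m : M) (a : A) (n : N) : tmul A (op a • m) n = tmul A m (a • n) :=
  (Submodule.Quotient.eq _).2 (Submodule.subset_span ⟨m, a, n, rfl⟩)

@[elab_as_elim]
theorem induction_on {motive : BTensor A M N → Prop} (t : BTensor A M N)
    (zero : motive 0) (tmul : ∀ m n, motive (tmul A m n))
    (add : ∀ s t, motive s → motive t → motive (s + t)) : motive t := by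
  obtain ⟨t, rfl⟩ := Submodule.Quotient.mk_surjective _ t
  induction t using TensorProduct.induction_on with
  | zero => exact zero
  | tmul m n => exact tmul m n
  | add s t hs ht => exact add _ _ hs ht

/-- The universal property: a biadditive balanced map on `M × N` extends to `M ⊗_A N`. -/
def lift (f : M → N → P) (hl : ∀ m m' n, f (m + m') n = f m n + f m' n)
    (hr : ∀ m n n', f m (n + n') = f m n + f m n')
    (hb : ∀ m (a : A) n, f (op a • m) n = f m (a • n)) : BTensor A M N →+ P :=
  (Submodule.liftQ _
    (TensorProduct.liftAddHom
      (AddMonoidHom.mk' (fun m => AddMonoidHom.mk' (f m) (hr m)) fun m m' =>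
        AddMonoidHom.ext fun n => hl m m' n)
      (fun r m n => by
        have h1 := map_zsmul (AddMonoidHom.mk' (fun m => f m n) fun m m' => hl m m' n) r m
        have h2 := map_zsmul (AddMonoidHom.mk' (f m) (hr m)) r n
        exact h1.trans h2.symm)).toIntLinearMap
    (by
      rw [Submodule.span_le]
      rintro _ ⟨m, a, n, rfl⟩
      rw [SetLike.mem_coe, LinearMap.mem_ker, map_sub, sub_eq_zero]
      exact hb m a n)).toAddMonoidHom

@[simp]
theorem lift_tmul (f : M → N → P) (hl hr) (hb : ∀ m (a : A) n, f (op a • m) n = f m (a • n))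
    (m : M) (n : N) : lift f hl hr hb (tmul A m n) = f m n := rfl

theorem hom_ext {f g : BTensor A M N →+ P} (h : ∀ m n, f (tmul A m n) = g (tmul A m n)) :
    f = g := by
  ext t
  induction t using induction_on with
  | zero => rw [map_zero, map_zero]
  | tmul m n => exact h m n
  | add s t hs ht => rw [map_add, map_add, hs, ht]

variable {M' N' M'' N'' : Type*} [AddCommGroup M'] [Module Aᵐᵒᵖ M'] [AddCommGroup N'] [Module A N']
  [AddCommGroup M''] [Module Aᵐᵒᵖ M''] [AddCommGroup N''] [Module A N'']

/-- `f ⊗_A g`. -/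
def map (f : M →ₗ[Aᵐᵒᵖ] M') (g : N →ₗ[A] N') : BTensor A M N →+ BTensor A M' N' :=
  lift (fun m n => tmul A (f m) (g n))
    (fun m m' n => by rw [map_add, add_tmul])
    (fun m n n' => by rw [map_add, tmul_add])
    (fun m a n => by rw [map_smul, map_smul, smul_tmul])

@[simp]
theorem map_tmul (f : M →ₗ[Aᵐᵒᵖ] M') (g : N →ₗ[A] N') (m : M) (n : N) :
    map f g (tmul A m n) = tmul A (f m) (g n) := rfl

theorem map_map (f : M →ₗ[Aᵐᵒᵖ] M') (g : N →ₗ[A] N') (f' : M' →ₗ[Aᵐᵒᵖ] M'') (g' : N' →ₗ[A] N'')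
    (t : BTensor A M N) : map f' g' (map f g t) = map (f' ∘ₗ f) (g' ∘ₗ g) t :=
  DFunLike.congr_fun (hom_ext (f := (map f' g').comp (map f g)) (g := map (f' ∘ₗ f) (g' ∘ₗ g))
    fun _ _ => rfl) t

theorem map_id_id (t : BTensor A M N) :
    map (LinearMap.id : M →ₗ[Aᵐᵒᵖ] M) (LinearMap.id : N →ₗ[A] N) t = t :=
  DFunLike.congr_fun (hom_ext (f := map LinearMap.id LinearMap.id) (g := AddMonoidHom.id _)
    fun _ _ => rfl) t

/-- `f ⊗_A N`. -/
abbrev rmap (N : Type*) [AddCommGroup N] [Module A N] (f : M →ₗ[Aᵐᵒᵖ] M') :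
    BTensor A M N →+ BTensor A M' N :=
  map f LinearMap.id

theorem rmap_rmap (f : M →ₗ[Aᵐᵒᵖ] M') (f' : M' →ₗ[Aᵐᵒᵖ] M'') (t : BTensor A M N) :
    rmap N f' (rmap N f t) = rmap N (f' ∘ₗ f) t :=
  map_map _ _ _ _ t

theorem rmap_add (f f' : M →ₗ[Aᵐᵒᵖ] M') (t : BTensor A M N) :
    rmap N (f + f') t = rmap N f t + rmap N f' t :=
  DFunLike.congr_fun (hom_ext (f := rmap N (f + f')) (g := rmap N f + rmap N f')
    fun _ _ => add_tmul _ _ _) t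

theorem rmap_neg (f : M →ₗ[Aᵐᵒᵖ] M') (t : BTensor A M N) : rmap N (-f) t = -rmap N f t := by
  rw [eq_neg_iff_add_eq_zero, ← rmap_add, neg_add_cancel]
  exact DFunLike.congr_fun (hom_ext (f := rmap N (0 : M →ₗ[Aᵐᵒᵖ] M')) (g := 0) fun m n => by
    have h := add_tmul (A := A) (0 : M') 0 n
    rw [add_zero] at h
    exact left_eq_add.1 h) t

theorem rmap_zero (t : BTensor A M N) : rmap N (0 : M →ₗ[Aᵐᵒᵖ] M') t = 0 := by
  have h := rmap_add (0 : M →ₗ[Aᵐᵒᵖ] M') 0 t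
  rw [add_zero] at h
  exact left_eq_add.1 h

/-! If `M` is an `(R, A)`-bimodule then `M ⊗_A N` is a left `R`-module; if `N` is an
`(A, S)`-bimodule then it is a right `S`-module. -/

instance leftModule {R : Type*} [Ring R] [Module R M] [SMulCommClass R Aᵐᵒᵖ M] :
    Module R (BTensor A M N) where
  smul r := rmap N (DistribSMul.toLinearMap Aᵐᵒᵖ M r)
  one_smul t := by
    refine Eq.trans (congrArg (fun f => rmap N f t) ?_) (map_id_id t)
    ext m; exact one_smul R m
  mul_smul r s t := by
    refine Eq.trans (congrArg (fun f => rmap N f t) ?_) (rmap_rmap _ _ t).symm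
    ext m; exact mul_smul r s m
  smul_zero r := _root_.map_zero _
  smul_add r := _root_.map_add _
  add_smul r s t := by
    refine Eq.trans (congrArg (fun f => rmap N f t) ?_) (rmap_add _ _ t)
    ext m; exact add_smul r s m
  zero_smul t := by
    refine Eq.trans (congrArg (fun f => rmap N f t) ?_) (rmap_zero (M' := M) t)
    ext m; exact zero_smul R m

theorem left_smul_def {R : Type*} [Ring R] [Module R M] [SMulCommClass R Aᵐᵒᵖ M] (r : R)
    (t : BTensor A M N) : r • t = rmap N (DistribSMul.toLinearMap Aᵐᵒᵖ M r) t := rfl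

theorem left_smul_tmul {R : Type*} [Ring R] [Module R M] [SMulCommClass R Aᵐᵒᵖ M] (r : R)
    (m : M) (n : N) : r • tmul A m n = tmul A (r • m) n := rfl

section Right

variable {S : Type*} [Ring S] [Module Sᵐᵒᵖ N] [SMulCommClass A Sᵐᵒᵖ N]

/-- Right multiplication by `s` on an `(A, S)`-bimodule, as a left `A`-linear map. -/
def rightMul (A N : Type*) [Ring A] [AddCommGroup N] [Module A N] {S : Type*} [Ring S]
    [Module Sᵐᵒᵖ N] [SMulCommClass A Sᵐᵒᵖ N] (s : Sᵐᵒᵖ) : N →ₗ[A] N where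
  toFun n := s • n
  map_add' := smul_add s
  map_smul' a n := (smul_comm a s n).symm

theorem map_id_add (g g' : N →ₗ[A] N') (t : BTensor A M N) :
    map (LinearMap.id : M →ₗ[Aᵐᵒᵖ] M) (g + g') t = map LinearMap.id g t + map LinearMap.id g' t :=
  DFunLike.congr_fun (hom_ext (f := map LinearMap.id (g + g'))
    (g := map LinearMap.id g + map LinearMap.id g') fun m n => by
      rw [AddMonoidHom.add_apply, map_tmul, map_tmul, map_tmul, LinearMap.add_apply, tmul_add]) t

instance rightModule : Module Sᵐᵒᵖ (BTensor A M N) where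
  smul s := map LinearMap.id (rightMul A N s)
  one_smul t := by
    refine Eq.trans (congrArg (fun f => map LinearMap.id f t) ?_) (map_id_id t)
    ext m; exact one_smul _ m
  mul_smul r s t := by
    refine Eq.trans (congrArg (fun f => map LinearMap.id f t) ?_)
      (map_map LinearMap.id _ LinearMap.id _ t).symm
    ext m; exact mul_smul r s m
  smul_zero r := _root_.map_zero _
  smul_add r := _root_.map_add _
  add_smul r s t := by
    refine Eq.trans (congrArg (fun f => map LinearMap.id f t) ?_) (map_id_add _ _ t)
    ext m; exact add_smul r s m
  zero_smul t := by
    have h := map_id_add (M := M) (rightMul A N (0 : Sᵐᵒᵖ)) (rightMul A N (0 : Sᵐᵒᵖ)) t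
    have e : rightMul A N (0 : Sᵐᵒᵖ) + rightMul A N (0 : Sᵐᵒᵖ) = rightMul A N (0 : Sᵐᵒᵖ) := by
      ext m
      change (0 : Sᵐᵒᵖ) • m + (0 : Sᵐᵒᵖ) • m = (0 : Sᵐᵒᵖ) • m
      rw [zero_smul, add_zero]
    rw [e] at h
    exact left_eq_add.1 h

theorem right_smul_tmul (s : Sᵐᵒᵖ) (m : M) (n : N) : s • tmul A m n = tmul A m (s • n) := rfl

instance {R : Type*} [Ring R] [Module R M] [SMulCommClass R Aᵐᵒᵖ M] :
    SMulCommClass R Sᵐᵒᵖ (BTensor A M N) where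
  smul_comm r s t :=
    (map_map LinearMap.id (rightMul A N s) (DistribSMul.toLinearMap Aᵐᵒᵖ M r) LinearMap.id t).trans
      (map_map (DistribSMul.toLinearMap Aᵐᵒᵖ M r) LinearMap.id LinearMap.id (rightMul A N s) t).symm

/-- `f ⊗_A N` as a right `S`-linear map, for an `(A, S)`-bimodule `N`. -/
def rmapₗ (S N : Type*) [Ring S] [AddCommGroup N] [Module A N] [Module Sᵐᵒᵖ N]
    [SMulCommClass A Sᵐᵒᵖ N] (f : M →ₗ[Aᵐᵒᵖ] M') : BTensor A M N →ₗ[Sᵐᵒᵖ] BTensor A M' N where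
  toFun := rmap N f
  map_add' := _root_.map_add _
  map_smul' s t :=
    (map_map LinearMap.id (rightMul A N s) f LinearMap.id t).trans
      (map_map f LinearMap.id LinearMap.id (rightMul A N s) t).symm

@[simp]
theorem rmapₗ_apply (f : M →ₗ[Aᵐᵒᵖ] M') (t : BTensor A M N) : rmapₗ S N f t = rmap N f t := rfl

/-- The right `S`-linear map `x ⊗ - : N → M ⊗_A N`. -/
def mkₗ (S N : Type*) [Ring S] [AddCommGroup N] [Module A N] [Module Sᵐᵒᵖ N]
    [SMulCommClass A Sᵐᵒᵖ N] (m : M) : N →ₗ[Sᵐᵒᵖ] BTensor A M N where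
  toFun n := tmul A m n
  map_add' := tmul_add m
  map_smul' _ _ := rfl

@[simp]
theorem mkₗ_apply (m : M) (n : N) : mkₗ (A := A) S N m n = tmul A m n := rfl

variable {Q : Type*} [AddCommGroup Q] [Module S Q]

/-- For a left `A`-linear map `g : P → N ⊗_S Q`, this is the map
`M ⊗_A g : M ⊗_A P → M ⊗_A (N ⊗_S Q) = (M ⊗_A N) ⊗_S Q`. If `g p = ∑ nᵢ ⊗ qᵢ` then it
sends `m ⊗ p` to `∑ (m ⊗ nᵢ) ⊗ qᵢ`. -/
def lmap (M : Type*) [AddCommGroup M] [Module Aᵐᵒᵖ M] [Module A P]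
    (g : P →ₗ[A] BTensor S N Q) : BTensor A M P →+ BTensor S (BTensor A M N) Q :=
  lift (fun m p => rmap Q (mkₗ S N m) (g p))
    (fun m m' p => by
      rw [← rmap_add]
      congr 2
      ext n
      exact add_tmul m m' n)
    (fun m p p' => by rw [map_add, map_add])
    (fun m a p => by
      rw [map_smul, left_smul_def, rmap_rmap]
      congr 2
      ext n
      exact smul_tmul m a n)

@[simp]
theorem lmap_tmul [Module A P] (g : P →ₗ[A] BTensor S N Q) (m : M) (p : P) :
    lmap M g (tmul A m p) = rmap Q (mkₗ S N m) (g p) := rfl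

/-- A balanced biadditive map that is right linear in the second variable extends to a right linear
map on the tensor product. -/
def liftₗ [Module Sᵐᵒᵖ P] (f : M → N → P) (hl : ∀ m m' n, f (m + m') n = f m n + f m' n)
    (hr : ∀ m n n', f m (n + n') = f m n + f m n')
    (hb : ∀ m (a : A) n, f (op a • m) n = f m (a • n))
    (hs : ∀ (s : Sᵐᵒᵖ) m n, f m (s • n) = s • f m n) : BTensor A M N →ₗ[Sᵐᵒᵖ] P where
  toFun := lift f hl hr hb
  map_add' := _root_.map_add _
  map_smul' s t := by
    rw [RingHom.id_apply]
    induction t using induction_on with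
    | zero => rw [smul_zero, map_zero, smul_zero]
    | add t t' ht ht' => rw [smul_add, map_add, ht, ht', map_add, smul_add]
    | tmul m n => exact hs s m n

@[simp]
theorem liftₗ_tmul [Module Sᵐᵒᵖ P] (f : M → N → P) (hl hr)
    (hb : ∀ m (a : A) n, f (op a • m) n = f m (a • n))
    (hs : ∀ (s : Sᵐᵒᵖ) m n, f m (s • n) = s • f m n) (m : M) (n : N) :
    liftₗ f hl hr hb hs (tmul A m n) = f m n := rfl

/-- The map `lmap M g` as a right linear map, when `g` is a bimodule map. -/
def lmapₗ {R : Type*} [Ring R] [Module Rᵐᵒᵖ Q] [SMulCommClass S Rᵐᵒᵖ Q] (M : Type*) [AddCommGroup M]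
    [Module Aᵐᵒᵖ M] [Module A P] [Module Rᵐᵒᵖ P] [SMulCommClass A Rᵐᵒᵖ P]
    (g : P →ₗ[A] BTensor S N Q) (hg : ∀ (r : Rᵐᵒᵖ) (p : P), g (r • p) = r • g p) :
    BTensor A M P →ₗ[Rᵐᵒᵖ] BTensor S (BTensor A M N) Q where
  toFun := lmap M g
  map_add' := _root_.map_add _
  map_smul' r t := by
    rw [RingHom.id_apply]
    induction t using induction_on with
    | zero => rw [smul_zero, map_zero, smul_zero]
    | add t t' ht ht' => rw [smul_add, map_add, ht, ht', map_add, smul_add]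
    | tmul m p =>
      rw [right_smul_tmul, lmap_tmul, lmap_tmul, hg]
      exact _root_.map_smul (rmapₗ R Q (mkₗ (A := A) S N m)) r (g p)

@[simp]
theorem lmapₗ_apply {R : Type*} [Ring R] [Module Rᵐᵒᵖ Q] [SMulCommClass S Rᵐᵒᵖ Q] [Module A P]
    [Module Rᵐᵒᵖ P] [SMulCommClass A Rᵐᵒᵖ P] (g : P →ₗ[A] BTensor S N Q)
    (hg : ∀ (r : Rᵐᵒᵖ) (p : P), g (r • p) = r • g p) (t : BTensor A M P) :
    lmapₗ M g hg t = lmap M g t := rfl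

end Right

/-- For a left linear `e : N → A`, the map `M ⊗_A e : M ⊗_A N → M ⊗_A A = M`, that is
`m ⊗ n ↦ m · e n`. -/
def contractRight (M : Type*) [AddCommGroup M] [Module Aᵐᵒᵖ M] (e : N →ₗ[A] A) :
    BTensor A M N →+ M :=
  lift (fun m n => op (e n) • m)
    (fun m m' n => smul_add _ m m')
    (fun m n n' => by rw [map_add, MulOpposite.op_add, add_smul])
    (fun m a n => by rw [map_smul, smul_eq_mul, op_mul, mul_smul])

/-- For a right linear `e : M → A`, the map `e ⊗_A N : M ⊗_A N → A ⊗_A N = N`, that is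
`m ⊗ n ↦ e m · n`. -/
def contractLeft (N : Type*) [AddCommGroup N] [Module A N] (e : M →ₗ[Aᵐᵒᵖ] A) :
    BTensor A M N →+ N :=
  lift (fun m n => e m • n)
    (fun m m' n => by rw [map_add, add_smul])
    (fun m n n' => smul_add _ n n')
    (fun m a n => by rw [map_smul, op_smul_eq_mul, mul_smul])

end BTensor

end BalancedTensor

open BTensor

section Coring

/-! ### Corings -/

/-- An `A`-coring, for an algebra `A` over the commutative ring `k`: an `A`-bimodule `C` (on which
`k` acts centrally) with `A`-bimodule maps `Δ : C → C ⊗_A C` and `ε : C → A`, coassociative and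
counital. -/
structure Coring (k : Type w) (A : Type u) [CommRing k] [Ring A] [Algebra k A] where
  carrier : Type u
  [addCommGroup : AddCommGroup carrier]
  [leftModule : Module A carrier]
  [rightModule : Module Aᵐᵒᵖ carrier]
  [smulCommClass : SMulCommClass A Aᵐᵒᵖ carrier]
  central : ∀ (c : k) (x : carrier), algebraMap k A c • x = op (algebraMap k A c) • x
  /-- The comultiplication, as a right linear map. -/
  comul : carrier →ₗ[Aᵐᵒᵖ] BTensor A carrier carrier
  comul_smul : ∀ (a : A) (x : carrier), comul (a • x) = a • comul x
  /-- The counit, as a right linear map. -/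
  counit : carrier →ₗ[Aᵐᵒᵖ] A
  counit_smul : ∀ (a : A) (x : carrier), counit (a • x) = a * counit x
  coassoc : ∀ x, rmap carrier comul (comul x) =
    lmap carrier { toFun := comul, map_add' := map_add comul, map_smul' := comul_smul } (comul x)
  counit_left : ∀ x, contractLeft carrier counit (comul x) = x
  counit_right : ∀ x, contractRight carrier
    { toFun := counit, map_add' := map_add counit, map_smul' := counit_smul } (comul x) = x

attribute [instance] Coring.addCommGroup Coring.leftModule Coring.rightModule Coring.smulCommClass

variable {k : Type w} [CommRing k] {A : Type u} [Ring A] [Algebra k A]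

namespace Coring

instance : CoeSort (Coring k A) (Type u) := ⟨Coring.carrier⟩

/-- The comultiplication as a left linear map. -/
def comulL (C : Coring k A) : C →ₗ[A] BTensor A C C where
  toFun := C.comul
  map_add' := map_add C.comul
  map_smul' := C.comul_smul

/-- The counit as a left linear map. -/
def counitL (C : Coring k A) : C →ₗ[A] A where
  toFun := C.counit
  map_add' := map_add C.counit
  map_smul' := C.counit_smul

end Coring

/-! ### Right comodules -/

/-- A right comodule over the `A`-coring `C`: a right `A`-module `M` with a right `A`-linear
coaction `ρ : M → M ⊗_A C`, coassociative and counital. -/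
structure RComod (C : Coring k A) where
  carrier : Type u
  [addCommGroup : AddCommGroup carrier]
  [module : Module Aᵐᵒᵖ carrier]
  coact : carrier →ₗ[Aᵐᵒᵖ] BTensor A carrier C
  coassoc : ∀ m, rmap C coact (coact m) = lmap carrier C.comulL (coact m)
  counit : ∀ m, contractRight carrier C.counitL (coact m) = m

attribute [instance] RComod.addCommGroup RComod.module

namespace RComod

variable {C : Coring k A}

instance : CoeSort (RComod C) (Type u) := ⟨RComod.carrier⟩

/-- A morphism of right comodules: a right linear map compatible with the coactions. -/
@[ext]
structure Hom (M N : RComod C) where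
  toLin : M →ₗ[Aᵐᵒᵖ] N
  comm : ∀ m, rmap C toLin (M.coact m) = N.coact (toLin m)

instance : Category (RComod C) where
  Hom := Hom
  id M := ⟨LinearMap.id, fun _ => map_id_id _⟩
  comp f g := ⟨g.toLin ∘ₗ f.toLin, fun m => by
    rw [← rmap_rmap, f.comm, g.comm]; rfl⟩

variable {M N P : RComod C}

/-- The right linear map underlying a morphism of comodules. -/
abbrev lin (f : M ⟶ N) : M →ₗ[Aᵐᵒᵖ] N := Hom.toLin f

theorem hom_comm (f : M ⟶ N) (m : M) : rmap C (lin f) (M.coact m) = N.coact (lin f m) :=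
  Hom.comm f m

theorem hom_ext {f g : M ⟶ N} (h : ∀ m, lin f m = lin g m) : f = g :=
  Hom.ext (LinearMap.ext h)

@[simp] theorem lin_id (m : M) : lin (𝟙 M) m = m := rfl

@[simp] theorem lin_comp (f : M ⟶ N) (g : N ⟶ P) (m : M) : lin (f ≫ g) m = lin g (lin f m) := rfl

instance : Zero (M ⟶ N) := ⟨⟨0, fun m => by rw [rmap_zero]; exact (map_zero N.coact).symm⟩⟩

instance : Add (M ⟶ N) := ⟨fun f g => ⟨lin f + lin g, fun m => by
  rw [rmap_add, hom_comm, hom_comm, LinearMap.add_apply, map_add]⟩⟩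

instance : Neg (M ⟶ N) := ⟨fun f => ⟨-lin f, fun m => by
  rw [rmap_neg, hom_comm, LinearMap.neg_apply, map_neg]⟩⟩

@[simp] theorem lin_zero (m : M) : lin (0 : M ⟶ N) m = 0 := rfl

@[simp] theorem lin_add (f g : M ⟶ N) (m : M) : lin (f + g) m = lin f m + lin g m := rfl

@[simp] theorem lin_neg (f : M ⟶ N) (m : M) : lin (-f) m = -lin f m := rfl

instance : AddCommGroup (M ⟶ N) where
  add_assoc f g h := hom_ext fun m => add_assoc _ _ _
  zero_add f := hom_ext fun m => zero_add _
  add_zero f := hom_ext fun m => add_zero _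
  add_comm f g := hom_ext fun m => add_comm _ _
  neg_add_cancel f := hom_ext fun m => neg_add_cancel _
  nsmul := nsmulRec
  zsmul := zsmulRec

theorem lin_sub (f g : M ⟶ N) (m : M) : lin (f - g) m = lin f m - lin g m := by
  rw [sub_eq_add_neg, lin_add, lin_neg, ← sub_eq_add_neg]

instance : Preadditive (RComod C) where
  add_comp _ _ _ f g h := hom_ext fun m => map_add (lin h) _ _
  comp_add _ _ _ f g h := hom_ext fun m => rfl

/-- Multiplication by a scalar `c : k` on the right `A`-module `N`, as an `A`-linear map. -/
def scalar (A N : Type*) [Ring A] [Algebra k A] [AddCommGroup N] [Module Aᵐᵒᵖ N] (c : k) :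
    N →ₗ[Aᵐᵒᵖ] N where
  toFun n := op (algebraMap k A c) • n
  map_add' := smul_add _
  map_smul' a n := by
    rw [RingHom.id_apply, ← mul_smul, ← mul_smul]
    congr 1
    rw [← MulOpposite.op_unop a, ← op_mul, ← op_mul, Algebra.commutes]

theorem scalar_tensor (N : Type*) [AddCommGroup N] [Module Aᵐᵒᵖ N] (C : Coring k A) (c : k)
    (t : BTensor A N C) : rmap C (scalar A N c) t = op (algebraMap k A c) • t :=
  DFunLike.congr_fun (BTensor.hom_ext (f := rmap C (scalar A N c))
    (g := DistribSMul.toAddMonoidHom _ (op (algebraMap k A c))) fun n x => by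
      change tmul A (op (algebraMap k A c) • n) x = tmul A n (op (algebraMap k A c) • x)
      rw [smul_tmul, C.central]) t

instance : SMul k (M ⟶ N) := ⟨fun c f => ⟨scalar A N c ∘ₗ lin f, fun m => by
  rw [← rmap_rmap, hom_comm, scalar_tensor]
  exact (map_smul N.coact _ _).symm⟩⟩

/-- The `k`-module structure on morphisms: `(c f)(m) = f(m) · c`. -/
theorem lin_smul (c : k) (f : M ⟶ N) (m : M) : lin (c • f) m = op (algebraMap k A c) • lin f m :=
  rfl

instance : Module k (M ⟶ N) where
  one_smul f := hom_ext fun m => by rw [lin_smul, map_one, op_one, one_smul]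
  mul_smul c d f := hom_ext fun m => by
    rw [lin_smul, lin_smul, lin_smul, map_mul, Algebra.commutes, op_mul, mul_smul]
  smul_zero c := hom_ext fun m => smul_zero _
  smul_add c f g := hom_ext fun m => smul_add _ _ _
  add_smul c d f := hom_ext fun m => by
    rw [lin_add, lin_smul, lin_smul, lin_smul, map_add, MulOpposite.op_add, add_smul]
  zero_smul f := hom_ext fun m => by rw [lin_smul, map_zero, MulOpposite.op_zero, zero_smul, lin_zero]

instance : Linear k (RComod C) where
  smul_comp _ _ _ c f g := hom_ext fun m => map_smul (lin g) _ _
  comp_smul _ _ _ f c g := hom_ext fun m => rfl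

end RComod

open RComod

/-! ### Comodules with a compatible left module structure -/

/-- A `(T, C)`-bicomodule, for a `k`-algebra `T` and an `A`-coring `C`: a right `C`-comodule with
a left `T`-module structure that makes it a `(T, A)`-bimodule (with `k` acting centrally) and
for which the coaction is left `T`-linear. -/
structure TComod (T : Type u) [Ring T] [Algebra k T] (C : Coring k A) extends RComod C where
  [leftModule : Module T carrier]
  [smulCommClass : SMulCommClass T Aᵐᵒᵖ carrier]
  central : ∀ (c : k) (m : carrier), algebraMap k T c • m = op (algebraMap k A c) • m
  coact_smul : ∀ (t : T) (m : carrier), coact (t • m) = t • coact m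

attribute [instance] TComod.leftModule TComod.smulCommClass

namespace TComod

variable {T : Type u} [Ring T] [Algebra k T] {C : Coring k A}

instance : CoeSort (TComod T C) (Type u) := ⟨fun M => M.toRComod.carrier⟩

/-- The coaction as a left `T`-linear map. -/
def coactL (M : TComod T C) : M →ₗ[T] BTensor A M C where
  toFun := M.coact
  map_add' := map_add M.coact
  map_smul' := M.coact_smul

theorem coactL_smul (M : TComod T C) (a : Aᵐᵒᵖ) (m : M) : M.coactL (a • m) = a • M.coactL m :=
  map_smul M.coact a m

/-- Left multiplication by `t` as a morphism of comodules. -/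
def leftMul (M : TComod T C) (t : T) : M.toRComod ⟶ M.toRComod :=
  ⟨DistribSMul.toLinearMap Aᵐᵒᵖ M t, fun m => (M.coact_smul t m).symm⟩

end TComod

/-- `C` as an `(A, C)`-bicomodule, with coaction `Δ`. -/
def Coring.self (C : Coring k A) : TComod A C where
  carrier := C
  coact := C.comul
  coassoc := C.coassoc
  counit := C.counit_right
  central := C.central
  coact_smul := C.comul_smul

section TensorComod

variable {T : Type u} [Ring T] [Algebra k T] {C : Coring k A}

/-- The comodule `X ⊗_T M` with coaction `X ⊗_T ρ_M`, for a right `T`-module `X` and a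
`(T, C)`-bicomodule `M`. -/
def tensorComod (X : Type u) [AddCommGroup X] [Module Tᵐᵒᵖ X] (M : TComod T C) : RComod C where
  carrier := BTensor T X M
  coact := lmapₗ X M.coactL M.coactL_smul
  coassoc t := by
    change rmap C _ (lmap X M.coactL t) = lmap _ C.comulL (lmap X M.coactL t)
    induction t using BTensor.induction_on with
    | zero => simp only [map_zero]
    | add s t hs ht => simp only [map_add, hs, ht]
    | tmul x m =>
      rw [lmap_tmul, rmap_rmap]
      change rmap C ((rmapₗ A C (mkₗ (A := T) A M x)) ∘ₗ M.coact) (M.coact m) =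
        lmap (BTensor T X M) C.comulL (rmap C (mkₗ A M x) (M.coact m))
      rw [← rmap_rmap, M.coassoc]
      generalize M.coact m = z
      induction z using BTensor.induction_on with
      | zero => simp only [map_zero]
      | add s t hs ht => simp only [map_add, hs, ht]
      | tmul m c =>
        rw [lmap_tmul, map_tmul, lmap_tmul, rmap_rmap]
        rfl
  counit t := by
    change contractRight _ C.counitL (lmap X M.coactL t) = t
    induction t using BTensor.induction_on with
    | zero => simp only [map_zero]
    | add s t hs ht => simp only [map_add, hs, ht]
    | tmul x m =>
      rw [lmap_tmul]
      conv_rhs => rw [← M.counit m]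
      change _ = mkₗ (A := T) A M x _
      change contractRight _ C.counitL (rmap C (mkₗ A M x) (M.coact m)) = _
      generalize M.coact m = z
      induction z using BTensor.induction_on with
      | zero => simp only [map_zero]
      | add s t hs ht => simp only [map_add, hs, ht]
      | tmul m c => rfl

/-- A right linear map on `X ⊗_T M` that respects the coactions on pure tensors is a morphism of
comodules. -/
def tensorHom {X : Type u} [AddCommGroup X] [Module Tᵐᵒᵖ X] {M : TComod T C} {N : RComod C}
    (f : BTensor T X M →ₗ[Aᵐᵒᵖ] N)
    (hf : ∀ x m, rmap C (f ∘ₗ mkₗ A M x) (M.coact m) = N.coact (f (tmul T x m))) :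
    tensorComod X M ⟶ N where
  toLin := f
  comm := by
    have h : ∀ t, rmap C f (lmap X M.coactL t) = N.coact (f t) := fun t => by
      induction t using BTensor.induction_on with
      | zero => simp only [map_zero]
      | add s t hs ht => simp only [map_add, hs, ht]
      | tmul x m =>
        rw [lmap_tmul, rmap_rmap]
        exact hf x m
    exact h

/-- The morphism of comodules `f ⊗_T M`. -/
def tensorMap {X Y : Type u} [AddCommGroup X] [Module Tᵐᵒᵖ X] [AddCommGroup Y] [Module Tᵐᵒᵖ Y]
    (f : X →ₗ[Tᵐᵒᵖ] Y) (M : TComod T C) : tensorComod X M ⟶ tensorComod Y M :=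
  tensorHom (rmapₗ A M f) fun _ _ => rfl

/-- For `x ∈ X`, the morphism of comodules `x ⊗ - : M → X ⊗_T M`. -/
def tensorMk {X : Type u} [AddCommGroup X] [Module Tᵐᵒᵖ X] (x : X) (M : TComod T C) :
    M.toRComod ⟶ tensorComod X M :=
  ⟨mkₗ A M x, fun _ => rfl⟩

end TensorComod

/-! ### The left structure on `F(M)` and the natural transformation `Υ` -/

variable {B : Type u} [Ring B] [Algebra k B] {C : Coring k A} {D : Coring k B}

section Upsilon

variable {T : Type u} [Ring T] [Algebra k T] (F : RComod C ⥤ RComod D) [F.Additive] [F.Linear k]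

/-- The left `T`-module structure on `F(M)` for a `(T, C)`-bicomodule `M`: `t` acts as
`F(t · -)`. -/
@[reducible]
def mapModule (M : TComod T C) : Module T (F.obj M.toRComod) where
  smul := fun t y => lin (F.map (M.leftMul t)) y
  one_smul := fun y => by
    change lin (F.map (M.leftMul 1)) y = y
    have : M.leftMul 1 = 𝟙 _ := RComod.hom_ext fun m => one_smul T m
    rw [this, F.map_id, lin_id]
  mul_smul := fun s t y => by
    change lin (F.map (M.leftMul (s * t))) y =
      lin (F.map (M.leftMul s)) (lin (F.map (M.leftMul t)) y)
    have : M.leftMul (s * t) = M.leftMul t ≫ M.leftMul s :=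
      RComod.hom_ext fun m => mul_smul s t m
    rw [this, F.map_comp, lin_comp]
  smul_zero := fun t => map_zero (lin (F.map (M.leftMul t)))
  smul_add := fun t => map_add (lin (F.map (M.leftMul t)))
  add_smul := fun s t y => by
    change lin (F.map (M.leftMul (s + t))) y =
      lin (F.map (M.leftMul s)) y + lin (F.map (M.leftMul t)) y
    have : M.leftMul (s + t) = M.leftMul s + M.leftMul t :=
      RComod.hom_ext fun m => add_smul s t m
    rw [this, F.map_add, lin_add]
  zero_smul := fun y => by
    change lin (F.map (M.leftMul 0)) y = 0
    have : M.leftMul 0 = 0 := RComod.hom_ext fun m => zero_smul T m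
    rw [this, F.map_zero, lin_zero]

/-- For a `k`-linear functor `F` and a `(T, C)`-bicomodule `M`, the `(T, D)`-bicomodule `F(M)`:
`t` acts on `F(M)` as `F(t · -)`. -/
def mapTComod (M : TComod T C) : TComod T D where
  toRComod := F.obj M.toRComod
  leftModule := mapModule F M
  smulCommClass :=
    letI := mapModule F M
    ⟨fun t b y => map_smul (lin (F.map (M.leftMul t))) b y⟩
  central c y := by
    change lin (F.map (M.leftMul (algebraMap k T c))) y = _
    have : M.leftMul (algebraMap k T c) = c • 𝟙 _ := RComod.hom_ext fun m => M.central c m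
    rw [this, Functor.map_smul, F.map_id, lin_smul, lin_id]
  coact_smul t y := (hom_comm (F.map (M.leftMul t)) y).symm

/-- For `x ∈ X`, the map `F(x ⊗ -) : F(M) → F(X ⊗_T M)`. -/
def mapMk {X : Type u} [AddCommGroup X] [Module Tᵐᵒᵖ X] (x : X) (M : TComod T C) :
    mapTComod F M →ₗ[Bᵐᵒᵖ] F.obj (tensorComod X M) :=
  lin (F.map (tensorMk x M))

theorem mapMk_add {X : Type u} [AddCommGroup X] [Module Tᵐᵒᵖ X] (x x' : X) (M : TComod T C) :
    mapMk F (x + x') M = mapMk F x M + mapMk F x' M := by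
  have : tensorMk (x + x') M = tensorMk x M + tensorMk x' M :=
    RComod.hom_ext fun m => add_tmul x x' m
  unfold mapMk
  rw [this, F.map_add]
  rfl

theorem mapMk_smul {X : Type u} [AddCommGroup X] [Module Tᵐᵒᵖ X] (t : T) (x : X) (M : TComod T C)
    (y : mapTComod F M) : mapMk F (op t • x) M y = mapMk F x M (t • y) := by
  have : tensorMk (op t • x) M = M.leftMul t ≫ tensorMk x M :=
    RComod.hom_ext fun m => smul_tmul x t m
  unfold mapMk
  rw [this, F.map_comp]
  rfl

/-- The morphism `Υ_{X,M} : X ⊗_T F(M) → F(X ⊗_T M)`, `x ⊗ y ↦ F(x ⊗ -)(y)`. It is natural in `X`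
and for `X = T` it is the canonical isomorphism `T ⊗_T F(M) ≅ F(M) ≅ F(T ⊗_T M)`; these two
properties determine it, because `x ⊗ y` is the image of `1 ⊗ y` under the map induced by
`T → X, t ↦ x · t`. -/
def upsilon (X : Type u) [AddCommGroup X] [Module Tᵐᵒᵖ X] (M : TComod T C) :
    tensorComod X (mapTComod F M) ⟶ F.obj (tensorComod X M) :=
  tensorHom
    (liftₗ (A := T) (fun x y => mapMk F x M y)
      (fun x x' y => by rw [mapMk_add, LinearMap.add_apply])
      (fun x y y' => map_add _ y y') (fun x t y => mapMk_smul F t x M y)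
      (fun b x y => map_smul _ b y))
    fun x y => hom_comm (F.map (tensorMk x M)) y

theorem upsilon_tmul (X : Type u) [AddCommGroup X] [Module Tᵐᵒᵖ X] (M : TComod T C) (x : X)
    (y : mapTComod F M) :
    lin (upsilon F X M) (tmul T x y) = lin (F.map (tensorMk x M)) y := rfl

end Upsilon

/-! ### Bicomodules and the cotensor product -/

/-- A left `C`-coaction on an `(A, D)`-bicomodule `M`, making it a `(C, D)`-bicomodule: a morphism
of right `D`-comodules `λ : M → C ⊗_A M` that is left `A`-linear, coassociative and counital. -/
structure LeftCoaction (C : Coring k A) (M : TComod A D) where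
  coact : M →ₗ[Bᵐᵒᵖ] BTensor A C M
  comm : ∀ m, rmap D coact (M.coact m) = (tensorComod C M).coact (coact m)
  coact_smul : ∀ (a : A) (m : M), coact (a • m) = a • coact m
  coassoc : ∀ m, rmap M C.comul (coact m) =
    lmap C { toFun := coact, map_add' := map_add coact, map_smul' := coact_smul } (coact m)
  counit : ∀ m, contractLeft M C.counit (coact m) = m

/-- The left `C`-coaction `Δ` on `C`: the coring `C` as a `(C, C)`-bicomodule. -/
def Coring.selfLeft (C : Coring k A) : LeftCoaction C C.self where
  coact := C.comul
  comm := C.coassoc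
  coact_smul := C.comul_smul
  coassoc := C.coassoc
  counit := C.counit_left

namespace LeftCoaction

variable {M : TComod A D} (L : LeftCoaction C M)

/-- The left coaction as a left linear map. -/
def coactL : M →ₗ[A] BTensor A C M where
  toFun := L.coact
  map_add' := map_add L.coact
  map_smul' := L.coact_smul

theorem coactL_smul (b : Bᵐᵒᵖ) (m : M) : L.coactL (b • m) = b • L.coactL m :=
  map_smul L.coact b m

/-- The left coaction as a morphism of right comodules. -/
def hom : M.toRComod ⟶ tensorComod C M := ⟨L.coact, L.comm⟩

/-- The morphism `ρ_N ⊗_A M : N ⊗_A M → (N ⊗_A C) ⊗_A M` of right `D`-comodules. -/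
def omegaLeft (_L : LeftCoaction C M) (N : RComod C) :
    tensorComod N M ⟶ tensorComod (BTensor A N C) M :=
  tensorMap N.coact M

/-- The morphism `N ⊗_A λ_M : N ⊗_A M → N ⊗_A (C ⊗_A M) = (N ⊗_A C) ⊗_A M` of right
`D`-comodules. -/
def omegaRight (N : RComod C) : tensorComod N M ⟶ tensorComod (BTensor A N C) M :=
  tensorHom (lmapₗ (A := A) (S := A) (R := B) (Q := M) N L.coactL L.coactL_smul)
    fun n m => hom_comm (L.hom ≫ tensorMap (mkₗ (A := A) A C n) M) m

/-- `ω_{N,M} = ρ_N ⊗_A M - N ⊗_A λ_M : N ⊗_A M → N ⊗_A C ⊗_A M`, as a morphism of right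
`D`-comodules. -/
def omega (N : RComod C) : tensorComod N M ⟶ tensorComod (BTensor A N C) M :=
  L.omegaLeft N - L.omegaRight N

theorem omega_naturality {N N' : RComod C} (f : N ⟶ N') :
    tensorMap (lin f) M ≫ L.omega N' = L.omega N ≫ tensorMap (rmapₗ A C (lin f)) M := by
  unfold omega
  rw [Preadditive.comp_sub, Preadditive.sub_comp]
  congr 1
  · refine RComod.hom_ext fun z => ?_
    have e : N'.coact ∘ₗ lin f = rmapₗ A C (lin f) ∘ₗ N.coact := by
      ext n
      exact (hom_comm f n).symm
    exact ((rmap_rmap (A := A) (N := M) (lin f) N'.coact z).trans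
      (congrArg (fun g => rmap M g z) e)).trans
      (rmap_rmap (A := A) (N := M) N.coact (rmapₗ A C (lin f)) z).symm
  · refine RComod.hom_ext fun z => ?_
    have e : ∀ z : BTensor A N M, lmap N' L.coactL (rmap M (lin f) z) =
        rmap M (rmapₗ A C (lin f)) (lmap N L.coactL z) := fun z => by
      induction z using BTensor.induction_on with
      | zero => simp only [map_zero]
      | add s t hs ht => simp only [map_add, hs, ht]
      | tmul n m =>
        rw [map_tmul, lmap_tmul, lmap_tmul, rmap_rmap]
        rfl
    exact e z

end LeftCoaction

/-! ### Kernels of comodule morphisms computed in modules -/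

section Kernel

variable {X Y X' Y' : RComod D}

/-- The kernel, in right `B`-modules, of a morphism of right `D`-comodules. -/
abbrev kerMod (f : X ⟶ Y) : Submodule Bᵐᵒᵖ X := LinearMap.ker (lin f)

/-- The kernel `K` of `f : X → Y` is preserved by `- ⊗_B D` (that is, `f` is `D`-pure) and
`K ⊗_B D ⊗_B D → X ⊗_B D ⊗_B D` is injective. Under this condition `K` is a `D`-comodule and it
is the kernel of `f` in the category of `D`-comodules. -/
structure PureKernel (f : X ⟶ Y) : Prop where
  injective : Function.Injective (rmap D (kerMod f).subtype)
  exact : ∀ t : BTensor B X D, rmap D (lin f) t = 0 → ∃ s, rmap D (kerMod f).subtype s = t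
  injective₂ : Function.Injective (rmap D (rmapₗ B D (kerMod f).subtype))

variable {f : X ⟶ Y} {f' : X' ⟶ Y'}

theorem PureKernel.exists_coact (h : PureKernel f) (x : kerMod f) :
    ∃ s, rmap D (kerMod f).subtype s = X.coact x :=
  h.exact _ (by rw [hom_comm, LinearMap.mem_ker.1 x.2, map_zero])

/-- The coaction on the kernel: the restriction of the coaction of `X`. -/
noncomputable def PureKernel.coact (h : PureKernel f) : kerMod f →ₗ[Bᵐᵒᵖ] BTensor B (kerMod f) D where
  toFun x := (h.exists_coact x).choose
  map_add' x y := h.injective (by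
    rw [map_add, (h.exists_coact _).choose_spec, (h.exists_coact _).choose_spec,
      (h.exists_coact _).choose_spec]
    exact map_add X.coact _ _)
  map_smul' b x := h.injective (by
    rw [RingHom.id_apply]
    refine Eq.trans ?_ (map_smul (rmapₗ B D (kerMod f).subtype) b _).symm
    rw [rmapₗ_apply, (h.exists_coact _).choose_spec, (h.exists_coact _).choose_spec]
    exact map_smul X.coact _ _)

theorem PureKernel.coact_spec (h : PureKernel f) (x : kerMod f) :
    rmap D (kerMod f).subtype (h.coact x) = X.coact x :=
  (h.exists_coact x).choose_spec

/-- The kernel of `f` as a right `D`-comodule. -/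
noncomputable def PureKernel.comod (h : PureKernel f) : RComod D where
  carrier := kerMod f
  coact := h.coact
  coassoc x := by
    apply h.injective₂
    have e1 : ∀ t : BTensor B (kerMod f) D,
        rmap D (rmapₗ B D (kerMod f).subtype) (rmap D h.coact t) =
          rmap D X.coact (rmap D (kerMod f).subtype t) := fun t => by
      rw [rmap_rmap, rmap_rmap]
      congr 2
      ext y
      exact h.coact_spec y
    have e2 : ∀ t : BTensor B (kerMod f) D,
        rmap D (rmapₗ B D (kerMod f).subtype) (lmap (kerMod f) D.comulL t) =
          lmap X D.comulL (rmap D (kerMod f).subtype t) := fun t => by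
      induction t using BTensor.induction_on with
      | zero => simp only [map_zero]
      | add s t hs ht => simp only [map_add, hs, ht]
      | tmul y d =>
        rw [lmap_tmul, map_tmul, lmap_tmul, rmap_rmap]
        rfl
    rw [e1, e2, h.coact_spec, X.coassoc]
  counit x := by
    apply (kerMod f).subtype_injective
    have e : ∀ t : BTensor B (kerMod f) D,
        (kerMod f).subtype (contractRight (kerMod f) D.counitL t) =
          contractRight X D.counitL (rmap D (kerMod f).subtype t) := fun t => by
      induction t using BTensor.induction_on with
      | zero => simp only [map_zero]
      | add s t hs ht => simp only [map_add, hs, ht]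
      | tmul y d => rfl
    rw [e, h.coact_spec, X.counit]
    rfl

/-- The inclusion of the kernel. -/
noncomputable def PureKernel.ι (h : PureKernel f) : h.comod ⟶ X :=
  ⟨(kerMod f).subtype, h.coact_spec⟩

/-- The morphism induced on kernels. -/
noncomputable def PureKernel.map (h : PureKernel f) (h' : PureKernel f') (a : X ⟶ X') (b : Y ⟶ Y')
    (w : a ≫ f' = f ≫ b) : h.comod ⟶ h'.comod :=
  have hk : ∀ x ∈ kerMod f, lin a x ∈ kerMod f' := fun x hx => by
    have e : lin (a ≫ f') x = lin (f ≫ b) x := by rw [w]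
    rw [lin_comp, lin_comp, LinearMap.mem_ker.1 hx, map_zero] at e
    exact e
  ⟨(lin a).restrict hk, fun (x : kerMod f) => h'.injective (by
    change rmap D _ (rmap D ((lin a).restrict hk) (h.coact x)) =
      rmap D _ (h'.coact ((lin a).restrict hk x))
    rw [h'.coact_spec, rmap_rmap]
    have e : (kerMod f').subtype ∘ₗ (lin a).restrict hk = lin a ∘ₗ (kerMod f).subtype := rfl
    rw [e, ← rmap_rmap, h.coact_spec, hom_comm]
    rfl)⟩

theorem PureKernel.map_ι (h : PureKernel f) (h' : PureKernel f') (a : X ⟶ X') (b : Y ⟶ Y')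
    (w : a ≫ f' = f ≫ b) : h.map h' a b w ≫ h'.ι = h.ι ≫ a := rfl

theorem PureKernel.lin_ι_injective (h : PureKernel f) : Function.Injective (lin h.ι) :=
  (kerMod f).subtype_injective

end Kernel

/-- The cotensor functor `- □_C M` from right `C`-comodules to right `D`-comodules, for a
`(C, D)`-bicomodule `M` such that the kernels `N □_C M` of `ω_{N,M}` are compatible with
`- ⊗_B D` for all `N`. It sends `f` to the restriction of `f ⊗_A M`. -/
noncomputable def cotensor {M : TComod A D} (L : LeftCoaction C M)
    (h : ∀ N : RComod C, PureKernel (L.omega N)) : RComod C ⥤ RComod D where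
  obj N := (h N).comod
  map f := PureKernel.map (h _) (h _) (tensorMap (lin f) M) (tensorMap (rmapₗ A C (lin f)) M)
    (L.omega_naturality f)
  map_id N := RComod.hom_ext fun x => (h N).lin_ι_injective (map_id_id (A := A) (M := N) (N := M) x.1)
  map_comp f g := RComod.hom_ext fun x => (h _).lin_ι_injective
    (rmap_rmap (A := A) (N := M) (lin f) (lin g) x.1).symm

end Coring

section Properties

open RComod

/-! ### Conditions on modules, corings and functors -/

/-- A left module `Z` is flat: `- ⊗ Z` preserves injectivity of maps of right modules. -/
def LeftFlat (B Z : Type u) [Ring B] [AddCommGroup Z] [Module B Z] : Prop :=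
  ∀ (X Y : Type u) [AddCommGroup X] [Module Bᵐᵒᵖ X] [AddCommGroup Y] [Module Bᵐᵒᵖ Y]
    (f : X →ₗ[Bᵐᵒᵖ] Y), Function.Injective f → Function.Injective (rmap Z f)

/-- A right module `Z` is flat: `Z ⊗ -` preserves injectivity of maps of left modules. -/
def RightFlat (A Z : Type u) [Ring A] [AddCommGroup Z] [Module Aᵐᵒᵖ Z] : Prop :=
  ∀ (X Y : Type u) [AddCommGroup X] [Module A X] [AddCommGroup Y] [Module A Y]
    (g : X →ₗ[A] Y), Function.Injective g →
      Function.Injective (BTensor.map (LinearMap.id : Z →ₗ[Aᵐᵒᵖ] Z) g)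

/-- A von Neumann regular ring. -/
def VonNeumannRegular (A : Type u) [Ring A] : Prop := ∀ a : A, ∃ x : A, a * x * a = a

variable {k : Type w} [CommRing k] {A : Type u} [Ring A] [Algebra k A]
  {B : Type u} [Ring B] [Algebra k B] {C : Coring k A} {D : Coring k B}

/-- `C` is coseparable: `Δ : C → C ⊗_A C` is a split monomorphism of `(C, C)`-bicomodules, that is,
there is a morphism of `(C, C)`-bicomodules `π : C ⊗_A C → C` with `π ∘ Δ = 1`. Here `C ⊗_A C` has
the right coaction `C ⊗_A Δ` and the left coaction `Δ ⊗_A C`, so `π` is an `A`-bimodule map with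
`(π ⊗_A C) ∘ (C ⊗_A Δ) = Δ ∘ π` and `(C ⊗_A π) ∘ (Δ ⊗_A C) = Δ ∘ π`; the last condition is
stated on `x ⊗ y`, where its left side is `∑ xᵢ ⊗ π (xᵢ' ⊗ y)` if `Δ x = ∑ xᵢ ⊗ xᵢ'`. -/
def Coseparable (C : Coring k A) : Prop :=
  ∃ (π : BTensor A C C →ₗ[Aᵐᵒᵖ] C) (hπ : ∀ (a : A) (t : BTensor A C C), π (a • t) = a • π t),
    (∀ t : BTensor A C C, rmap C π (lmap C C.comulL t) = C.comul (π t)) ∧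
    (∀ x y : C,
      BTensor.map LinearMap.id
        ({ toFun := fun z => π (tmul A z y)
           map_add' := fun z z' => by rw [add_tmul, map_add]
           map_smul' := fun a z => hπ a (tmul A z y) } : C →ₗ[A] C) (C.comul x) =
        C.comul (π (tmul A x y))) ∧
    ∀ x : C, π (C.comul x) = x

variable (C D) in
/-- Both comodule categories are abelian and `C` is coseparable. -/
def CoseparableAbelian : Prop :=
  Coseparable C ∧ Nonempty (Abelian (RComod C)) ∧ Nonempty (Abelian (RComod D))

/-- `_B D` is flat and `F` preserves the kernel of `ρ_N ⊗_A C - N ⊗_A Δ : N ⊗_A C → N ⊗_A C ⊗_A C`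
(in the category of right `C`-comodules) for every right `C`-comodule `N`. -/
def FlatPreservesKernels (F : RComod C ⥤ RComod D) : Prop :=
  LeftFlat B D ∧ ∀ N : RComod C, PreservesLimit (parallelPair (C.selfLeft.omega N) 0) F

/-- `F` preserves coproducts. -/
def PreservesCoproducts (F : RComod C ⥤ RComod D) : Prop :=
  ∀ J : Type u, PreservesColimitsOfShape (Discrete J) F

/-- `F` preserves direct limits, that is, colimits of directed systems. -/
def PreservesDirectLimits (F : RComod C ⥤ RComod D) : Prop :=
  ∀ (J : Type u) [Preorder J] [IsDirectedOrder J] [Nonempty J], PreservesColimitsOfShape J F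

/-- `F` preserves inductive limits, that is, all small colimits. -/
def PreservesInductiveLimits (F : RComod C ⥤ RComod D) : Prop :=
  PreservesColimitsOfSize.{u, u} F

/-- `Υ_{N,C}` and `Υ_{N ⊗_A C,C}` are isomorphisms for every right `C`-comodule `N`. -/
def UpsilonIso (F : RComod C ⥤ RComod D) [F.Additive] [F.Linear k] : Prop :=
  ∀ N : RComod C, IsIso (upsilon F N C.self) ∧ IsIso (upsilon F (BTensor A N C) C.self)

/-- `F` is naturally isomorphic to `- □_C F(C)`. This comprises: `Υ_{C,C}` is an isomorphism, the
left coaction `Υ_{C,C}⁻¹ ∘ F(Δ)` makes `F(C)` a `(C, D)`-bicomodule, the functor `- □_C F(C)` with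
values in right `D`-comodules is defined, and `F` is naturally isomorphic to it. -/
def IsoCotensor (F : RComod C ⥤ RComod D) [F.Additive] [F.Linear k] : Prop :=
  ∃ L : LeftCoaction C (mapTComod F C.self),
    IsIso (upsilon F C C.self) ∧
    L.hom ≫ upsilon F C C.self = F.map C.selfLeft.hom ∧
    ∃ h : ∀ N : RComod C, PureKernel (L.omega N), Nonempty (F ≅ cotensor L h)

end Properties

end Corings

open Corings

namespace Corings

/-! ### Balanced tensor products: exactness and flatness -/

namespace BTensor

variable {A M M' N N' : Type*} [Ring A] [AddCommGroup M] [Module Aᵐᵒᵖ M] [AddCommGroup M']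
  [Module Aᵐᵒᵖ M'] [AddCommGroup N] [Module A N] [AddCommGroup N'] [Module A N']

/-! In the category of right C-comodules the coaction ρ_N is the kernel of ω_{N,C} : N ⊗ C → N ⊗ C ⊗
C: contracting with the counit recovers N from N ⊗ C and factors every morphism killed by ω_{N,C}
(`isLimitCoactHom`). Since Υ is natural, it intertwines ω_{N,F(C)} with F(ω_{N,C})
(`omega_upsilon`). If F preserves the kernel of ω_{N,C} and Υ_{N,C}, Υ_{N⊗C,C} are invertible, then
F(N) is therefore the kernel of ω_{N,F(C)}, which is N □_C F(C). The bicomodule axioms of F(C) are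
the axioms of C pushed through F and carried back along Υ.

It remains to control kernels. If _B D is flat, every kernel of D-comodules is computed in modules
(`pureKernel_of_leftFlat`), and preservation by F is part of the hypothesis. If C is coseparable,
the bicolinear retraction π of Δ writes the identity of N ⊗ C as p + qω with ωp = 0. Such an
equational splitting survives every additive functor and every isomorphism, and it makes kernels
absolute (`HasSplitKernel`).

It also remains to invert Υ. Both sides of Υ_{X,M} are functors of X, - ⊗_T M preserves colimits
because it is a left adjoint, and Υ_{T,M} is invertible. Invertibility then spreads from T: to
projectives when F preserves coproducts, and to all modules, through free presentations, when F
preserves colimits. Over a von Neumann regular ring direct limits suffice: a finitely generated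
submodule of a free module is a summand (`VonNeumannRegular.exists_projection`), so every module is
a direct limit of retracts of free modules. The same summand property gives flatness
(`VonNeumannRegular.rightFlat`). -/

theorem tmul_zero (m : M) : tmul A m (0 : N) = 0 := by
  have h := tmul_add (A := A) m (0 : N) 0
  rw [add_zero] at h
  exact left_eq_add.1 h

theorem zero_tmul (n : N) : tmul A (0 : M) n = 0 := by
  have h := add_tmul (A := A) (0 : M) 0 n
  rw [add_zero] at h
  exact left_eq_add.1 h

theorem sub_tmul (m m' : M) (n : N) : tmul A (m - m') n = tmul A m n - tmul A m' n := by
  rw [eq_sub_iff_add_eq, ← add_tmul, sub_add_cancel]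

/-- Right exactness of `- ⊗_A N`. -/
theorem exists_rmap_subtype_eq {π : M →ₗ[Aᵐᵒᵖ] M'} (hπ : Function.Surjective π)
    (t : BTensor A M N) (ht : rmap N π t = 0) :
    ∃ s, rmap N (LinearMap.ker π).subtype s = t := by
  -- The aim is an inverse M' ⊗ N → (M ⊗ N)/S of the map induced by π. A set-theoretic section σ of
  -- π is enough, because by `key` the class of m ⊗ n depends only on π m.
  let S : AddSubgroup (BTensor A M N) := (rmap N (LinearMap.ker π).subtype).range
  have key : ∀ (m m₁ : M) (n : N), π m = π m₁ →
      QuotientAddGroup.mk' S (tmul A m n) = QuotientAddGroup.mk' S (tmul A m₁ n) := by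
    intro m m₁ n h
    rw [← sub_eq_zero, ← map_sub, ← sub_tmul]
    refine (QuotientAddGroup.eq_zero_iff _).2 ⟨tmul A ⟨m - m₁, ?_⟩ n, rfl⟩
    rw [LinearMap.mem_ker, map_sub, h, sub_self]
  let σ := Function.surjInv hπ
  have hσ : ∀ m, π (σ m) = m := Function.surjInv_eq hπ
  let g : BTensor A M' N →+ BTensor A M N ⧸ S :=
    lift (fun m n => QuotientAddGroup.mk' S (tmul A (σ m) n))
      (fun m m' n => by
        rw [← map_add, ← add_tmul]
        exact key _ _ _ (by rw [map_add, hσ, hσ, hσ]))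
      (fun m n n' => by rw [tmul_add, map_add])
      (fun m a n => by
        rw [← smul_tmul]
        exact key _ _ _ (by rw [map_smul, hσ, hσ]))
  have hg : g.comp (rmap N π) = QuotientAddGroup.mk' S :=
    hom_ext fun m n => key _ _ _ (hσ _)
  have h := DFunLike.congr_fun hg t
  rw [AddMonoidHom.comp_apply, ht, map_zero] at h
  exact (QuotientAddGroup.eq_zero_iff _).1 h.symm

/-- Free right modules are flat. -/
theorem map_id_injective_of_finsupp (J : Type*) {g : N →ₗ[A] N'} (hg : Function.Injective g) :
    Function.Injective
      (BTensor.map (LinearMap.id : (J →₀ Aᵐᵒᵖ) →ₗ[Aᵐᵒᵖ] (J →₀ Aᵐᵒᵖ)) g) := by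
  classical
  -- Contraction with the coordinate functional `e j` extracts the j-th N-coordinate of a tensor; a
  -- tensor is recovered from finitely many of these.
  let e (j : J) : (J →₀ Aᵐᵒᵖ) →ₗ[Aᵐᵒᵖ] A :=
    { toFun := fun x => unop (x j)
      map_add' := fun x y => rfl
      map_smul' := fun a x => rfl }
  have hdecomp : ∀ t : BTensor A (J →₀ Aᵐᵒᵖ) N, ∃ s : Finset J,
      t = ∑ j ∈ s, tmul A (Finsupp.single j 1) (contractLeft N (e j) t) := by
    intro t
    -- Allowing every larger index set lets the two summands of a sum share one set.
    suffices H : ∃ s : Finset J, ∀ s', s ⊆ s' →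
        t = ∑ j ∈ s', tmul A (Finsupp.single j 1) (contractLeft N (e j) t) by
      obtain ⟨s, hs⟩ := H
      exact ⟨s, hs s subset_rfl⟩
    induction t using BTensor.induction_on with
    | zero => exact ⟨∅, fun s _ => by simp only [map_zero, tmul_zero, Finset.sum_const_zero]⟩
    | add t t' ht ht' =>
      obtain ⟨s, hs⟩ := ht
      obtain ⟨s', hs'⟩ := ht'
      refine ⟨s ∪ s', fun u hu => ?_⟩
      simp only [map_add, tmul_add, Finset.sum_add_distrib]
      rw [← hs u (Finset.union_subset_left hu), ← hs' u (Finset.union_subset_right hu)]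
    | tmul x n =>
      refine ⟨x.support, fun u hu => ?_⟩
      have h1 : ∀ j, tmul A (Finsupp.single j 1) (contractLeft N (e j) (tmul A x n)) =
          tmul A (Finsupp.single j (x j)) n := fun j => by
        change tmul A (Finsupp.single j 1) (unop (x j) • n) = _
        rw [← smul_tmul, op_unop, Finsupp.smul_single, smul_eq_mul, mul_one]
      rw [Finset.sum_congr rfl fun j _ => h1 j]
      let T : (J →₀ Aᵐᵒᵖ) →+ BTensor A (J →₀ Aᵐᵒᵖ) N :=
        AddMonoidHom.mk' (fun y => tmul A y n) fun y y' => add_tmul y y' n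
      change T x = ∑ j ∈ u, T (Finsupp.single j (x j))
      rw [← map_sum]
      congr 1
      conv_lhs => rw [← Finsupp.sum_single x]
      exact Finsupp.sum_of_support_subset _ hu _ fun _ _ => Finsupp.single_zero _
  rw [injective_iff_map_eq_zero]
  intro t ht
  obtain ⟨s, hs⟩ := hdecomp t
  rw [hs]
  refine Finset.sum_eq_zero fun j _ => ?_
  have h2 : ∀ t : BTensor A (J →₀ Aᵐᵒᵖ) N, contractLeft N' (e j) (BTensor.map LinearMap.id g t) =
      g (contractLeft N (e j) t) := fun t => by
    induction t using BTensor.induction_on with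
    | zero => simp only [map_zero]
    | add s t hs ht => simp only [map_add, hs, ht]
    | tmul x n => exact (map_smul g _ _).symm
  have h3 : contractLeft N (e j) t = 0 := hg (by rw [← h2, ht, map_zero, map_zero])
  rw [h3, tmul_zero]

end BTensor

open BTensor

/-! ### Modules over von Neumann regular rings -/

section Regular

variable {R : Type*} [Ring R]

theorem VonNeumannRegular.mulOpposite {A : Type*} [Ring A] (h : VonNeumannRegular A) :
    VonNeumannRegular Aᵐᵒᵖ := fun a => by
  obtain ⟨x, hx⟩ := h (unop a)
  exact ⟨op x, unop_injective (by simpa [mul_assoc] using hx)⟩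

/-- Free modules over a von Neumann regular ring are regular. -/
theorem VonNeumannRegular.exists_dual_smul_eq (h : VonNeumannRegular R) {J : Type*}
    (x : J →₀ R) : ∃ f : (J →₀ R) →ₗ[R] R, f x • x = x := by
  classical
  -- The functional is corrected one coordinate at a time: f x need only act as a left identity on
  -- the coordinates in s.
  suffices H : ∀ s : Finset J, ∃ f : (J →₀ R) →ₗ[R] R, ∀ j ∈ s, f x * x j = x j by
    obtain ⟨f, hf⟩ := H x.support
    refine ⟨f, Finsupp.ext fun j => ?_⟩
    rw [Finsupp.smul_apply, smul_eq_mul]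
    by_cases hj : j ∈ x.support
    · exact hf j hj
    · rw [Finsupp.notMem_support_iff.1 hj, mul_zero]
  intro s
  induction s using Finset.induction_on with
  | empty => exact ⟨0, fun j hj => absurd hj (Finset.notMem_empty j)⟩
  | insert i s _ ih =>
    obtain ⟨f, hf⟩ := ih
    -- With d = x i - f x * x i and d g d = d, the new functional f' satisfies 1 - f' x = (1 - d
    -- g)(1 - f x). This still annihilates the coordinates killed by 1 - f x, and it annihilates x i
    -- because (1 - f x) * x i = d.
    obtain ⟨g, hg⟩ := h (x i - f x * x i)
    refine ⟨f + LinearMap.toSpanSingleton R R (g * (1 - f x)) ∘ₗ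
      (Finsupp.lapply i - LinearMap.toSpanSingleton R R (x i) ∘ₗ f), fun j hj => ?_⟩
    simp only [LinearMap.add_apply, LinearMap.comp_apply, LinearMap.sub_apply,
      LinearMap.toSpanSingleton_apply, Finsupp.lapply_apply, smul_eq_mul]
    rcases Finset.mem_insert.1 hj with rfl | hj
    · have e : (1 - f x) * x j = x j - f x * x j := by rw [sub_mul, one_mul]
      rw [add_mul, mul_assoc, mul_assoc g, e, ← mul_assoc, hg, add_sub_cancel]
    · have e : (1 - f x) * x j = 0 := by rw [sub_mul, one_mul, hf j hj, sub_self]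
      rw [add_mul, mul_assoc, mul_assoc g, e, mul_zero, mul_zero, add_zero, hf j hj]

/-- A finitely generated submodule of a free module over a von Neumann regular ring is a direct
summand. -/
theorem VonNeumannRegular.exists_projection (h : VonNeumannRegular R) {J : Type*}
    (K : Submodule R (J →₀ R)) (hK : K.FG) :
    ∃ p : (J →₀ R) →ₗ[R] (J →₀ R), (∀ x, p x ∈ K) ∧ ∀ x ∈ K, p x = x := by
  classical
  obtain ⟨s, rfl⟩ := hK
  suffices H : ∃ p : (J →₀ R) →ₗ[R] (J →₀ R),
      (∀ x, p x ∈ Submodule.span R (s : Set (J →₀ R))) ∧ ∀ x ∈ s, p x = x by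
    obtain ⟨p, hp, hp'⟩ := H
    exact ⟨p, hp, fun x hx => LinearMap.eqOn_span (f := p) (g := LinearMap.id) hp' hx⟩
  induction s using Finset.induction_on with
  | empty => exact ⟨0, fun x => Submodule.zero_mem _, fun x hx => absurd hx (Finset.notMem_empty x)⟩
  | insert x s _ ih =>
    obtain ⟨p, hp, hp'⟩ := ih
    -- A rank one correction in the direction x - p x: it vanishes on vectors already fixed by p,
    -- and f is chosen so that it adds exactly x - p x to p x.
    obtain ⟨f, hf⟩ := h.exists_dual_smul_eq (x - p x)
    have hs : ∀ y, p y ∈ Submodule.span R ((insert x s : Finset _) : Set (J →₀ R)) := fun y =>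
      Submodule.span_mono (Finset.coe_subset.2 (Finset.subset_insert x s)) (hp y)
    refine ⟨p + LinearMap.toSpanSingleton R _ (x - p x) ∘ₗ f ∘ₗ (LinearMap.id - p),
      fun y => Submodule.add_mem _ (hs y) (Submodule.smul_mem _ _ (Submodule.sub_mem _
        (Submodule.subset_span (Finset.mem_insert_self x s)) (hs x))), fun y hy => ?_⟩
    change p y + f (y - p y) • (x - p x) = y
    rcases Finset.mem_insert.1 hy with rfl | hy
    · rw [hf, add_sub_cancel]
    · rw [hp' y hy, sub_self, map_zero, zero_smul, add_zero]

end Regular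

/-- Every module over a von Neumann regular ring is flat. -/
theorem VonNeumannRegular.rightFlat {A : Type u} [Ring A] (h : VonNeumannRegular A) (Z : Type u)
    [AddCommGroup Z] [Module Aᵐᵒᵖ Z] : RightFlat A Z := by
  intro X Y _ _ _ _ g hg
  rw [injective_iff_map_eq_zero]
  intro t ht
  let π : (Z →₀ Aᵐᵒᵖ) →ₗ[Aᵐᵒᵖ] Z := Finsupp.linearCombination _ id
  have hπ : Function.Surjective π := Finsupp.linearCombination_id_surjective _ _
  have hlift : ∀ t : BTensor A Z X, ∃ t', rmap X π t' = t := fun t => by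
    induction t using BTensor.induction_on with
    | zero => exact ⟨0, map_zero _⟩
    | add s t hs ht =>
      obtain ⟨s', hs⟩ := hs
      obtain ⟨t', ht⟩ := ht
      exact ⟨s' + t', by rw [map_add, hs, ht]⟩
    | tmul z x =>
      obtain ⟨z', rfl⟩ := hπ z
      exact ⟨tmul A z' x, rfl⟩
  obtain ⟨t, rfl⟩ := hlift t
  rw [map_map] at ht
  obtain ⟨s, hs⟩ := exists_rmap_subtype_eq hπ (BTensor.map LinearMap.id g t)
    (by rw [map_map]; exact ht)
  -- Only finitely many relations from the kernel of π occur in s; K is their span. A map p fixing K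
  -- yields 1 - p, which kills the image of s in the free module tensored with Y.
  have hK : ∀ s : BTensor A (LinearMap.ker π) Y, ∃ K : Submodule Aᵐᵒᵖ (Z →₀ Aᵐᵒᵖ), K.FG ∧
      K ≤ LinearMap.ker π ∧ ∀ p : (Z →₀ Aᵐᵒᵖ) →ₗ[Aᵐᵒᵖ] (Z →₀ Aᵐᵒᵖ), (∀ x ∈ K, p x = x) →
        rmap Y (LinearMap.id - p) (rmap Y (LinearMap.ker π).subtype s) = 0 := fun s => by
    induction s using BTensor.induction_on with
    | zero => exact ⟨⊥, Submodule.fg_bot, bot_le, fun p _ => by rw [map_zero, map_zero]⟩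
    | add s t hs ht =>
      obtain ⟨K, hK, hK', hs⟩ := hs
      obtain ⟨L, hL, hL', ht⟩ := ht
      exact ⟨K ⊔ L, hK.sup hL, sup_le hK' hL', fun p hp => by
        rw [map_add, map_add, hs p fun x hx => hp x (Submodule.mem_sup_left hx),
          ht p fun x hx => hp x (Submodule.mem_sup_right hx), add_zero]⟩
    | tmul z y =>
      refine ⟨Submodule.span _ {z.1}, Submodule.fg_span_singleton _,
        (Submodule.span_singleton_le_iff_mem _ _).2 z.2, fun p hp => ?_⟩
      change tmul A (z.1 - p z.1) y = 0
      rw [hp _ (Submodule.mem_span_singleton_self _), sub_self, zero_tmul]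
  obtain ⟨K, hKfg, hKle, hKs⟩ := hK s
  obtain ⟨p, hp, hp'⟩ := h.mulOpposite.exists_projection K hKfg
  have e := hKs p hp'
  rw [hs, map_map, show (LinearMap.id - p) ∘ₗ LinearMap.id = LinearMap.id ∘ₗ (LinearMap.id - p) from
    rfl, show LinearMap.id ∘ₗ g = g ∘ₗ LinearMap.id from rfl, ← map_map] at e
  have e' : rmap X (LinearMap.id - p) t = 0 :=
    map_id_injective_of_finsupp Z hg (by rw [e, map_zero])
  -- Since p takes values in K, inside the kernel of π, replacing t by its image under 1 - p does
  -- not change the element of Z ⊗ X, and that image is zero by flatness of the free module.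
  have e'' : π = π ∘ₗ (LinearMap.id - p) := LinearMap.ext fun x => by
    change π x = π (x - p x)
    rw [map_sub, LinearMap.mem_ker.1 (hKle (hp x)), sub_zero]
  rw [e'', ← rmap_rmap, e', map_zero]

end Corings

namespace Corings

open BTensor RComod

variable {k : Type w} [CommRing k] {A : Type u} [Ring A] [Algebra k A]
  {B : Type u} [Ring B] [Algebra k B] {C : Coring k A} {D : Coring k B}
  {T : Type u} [Ring T] [Algebra k T]

/-! ### The functor `- ⊗_T M` and its right adjoint -/

section TensorFunctor

theorem tensorComod_hom_ext {X : Type u} [AddCommGroup X] [Module Tᵐᵒᵖ X] {M : TComod T C}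
    {N : RComod C} {f g : tensorComod X M ⟶ N}
    (h : ∀ x, tensorMk x M ≫ f = tensorMk x M ≫ g) : f = g := by
  refine RComod.hom_ext fun (t : BTensor T X M) => ?_
  induction t using BTensor.induction_on with
  | zero => exact (map_zero (lin f)).trans (map_zero (lin g)).symm
  | add s t hs ht =>
    exact (map_add (lin f) s t).trans ((congrArg₂ _ hs ht).trans (map_add (lin g) s t).symm)
  | tmul x m => exact congrArg (fun e : M.toRComod ⟶ N => lin e m) (h x)

/-- The functor `- ⊗_T M` from right `T`-modules to right `C`-comodules. -/
def tensorFunctor (M : TComod T C) : ModuleCat.{u} Tᵐᵒᵖ ⥤ RComod C where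
  obj X := tensorComod X M
  map f := tensorMap f.hom M
  map_id X := RComod.hom_ext fun t => map_id_id (A := T) (M := X) (N := M) t
  map_comp f g := RComod.hom_ext fun t => (rmap_rmap (A := T) (N := M) f.hom g.hom t).symm

instance (M : TComod T C) : (tensorFunctor M).Additive where
  map_add {_ _ f g} := RComod.hom_ext fun t => rmap_add (A := T) (N := M) f.hom g.hom t

/-- The right `T`-module structure on the comodule morphisms out of a `(T, C)`-bicomodule. -/
@[reducible]
def homModule (M : TComod T C) (Z : RComod C) : Module Tᵐᵒᵖ (M.toRComod ⟶ Z) where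
  smul t f := M.leftMul (unop t) ≫ f
  one_smul f := RComod.hom_ext fun m => congrArg (lin f) (one_smul T m)
  mul_smul s t f := RComod.hom_ext fun m => congrArg (lin f) (mul_smul (unop t) (unop s) m)
  smul_zero _ := RComod.hom_ext fun _ => rfl
  smul_add _ _ _ := RComod.hom_ext fun _ => rfl
  add_smul s t f := RComod.hom_ext fun m =>
    (congrArg (lin f) (add_smul (unop s) (unop t) m)).trans (map_add (lin f) _ _)
  zero_smul f := RComod.hom_ext fun m =>
    (congrArg (lin f) (zero_smul T m)).trans (map_zero (lin f))

/-- The functor of comodule morphisms out of a `(T, C)`-bicomodule. -/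
def homFunctor (M : TComod T C) : RComod C ⥤ ModuleCat.{u} Tᵐᵒᵖ where
  obj Z := letI := homModule M Z; ModuleCat.of Tᵐᵒᵖ (M.toRComod ⟶ Z)
  map {Z Z'} g :=
    letI := homModule M Z
    letI := homModule M Z'
    ModuleCat.ofHom
      { toFun := fun f : M.toRComod ⟶ Z => f ≫ g
        map_add' := fun f f' => Preadditive.add_comp _ _ _ f f' g
        map_smul' := fun _ _ => Category.assoc _ _ _ }

/-- The adjunction between `- ⊗_T M` and `Hom(M, -)`. -/
def tensorHomAdjunction (M : TComod T C) : tensorFunctor M ⊣ homFunctor M :=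
  Adjunction.mkOfHomEquiv
    { homEquiv := fun X Z =>
        letI := homModule M Z
        { toFun := fun f => ModuleCat.ofHom
            { toFun := fun x : X => (tensorMk x M ≫ f : M.toRComod ⟶ Z)
              map_add' := fun x x' => RComod.hom_ext fun m =>
                (congrArg (lin f) (add_tmul x x' m)).trans (map_add (lin f) _ _)
              map_smul' := fun t x => RComod.hom_ext fun m =>
                congrArg (lin f) (smul_tmul x (unop t) m) }
          invFun := fun g => tensorHom
            (liftₗ (A := T) (fun (x : X) (m : M) => lin (g.hom x : M.toRComod ⟶ Z) m)
              (fun x x' m => by rw [map_add]; rfl)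
              (fun x m m' => map_add _ m m')
              (fun x t m => by rw [map_smul]; rfl)
              (fun b x m => map_smul _ b m))
            fun x m => hom_comm (g.hom x : M.toRComod ⟶ Z) m
          left_inv := fun f => tensorComod_hom_ext fun x => rfl
          right_inv := fun g => rfl }
      homEquiv_naturality_left_symm := fun f g => tensorComod_hom_ext fun x => rfl
      homEquiv_naturality_right := fun f g => rfl }

instance (M : TComod T C) : PreservesColimitsOfSize.{u, u} (tensorFunctor M) :=
  (tensorHomAdjunction M).leftAdjoint_preservesColimits

/-- `Υ_{-,M}` as a natural transformation. -/
def upsilonNat (F : RComod C ⥤ RComod D) [F.Additive] [F.Linear k] (M : TComod T C) :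
    tensorFunctor (mapTComod F M) ⟶ tensorFunctor M ⋙ F where
  app X := upsilon F X M
  naturality _ _ f := tensorComod_hom_ext fun x =>
    (congrArg F.map (show tensorMk (f.hom x) M = tensorMk x M ≫ tensorMap f.hom M from rfl)).trans
      (F.map_comp _ _)

theorem upsilon_naturality (F : RComod C ⥤ RComod D) [F.Additive] [F.Linear k] {X Y : Type u}
    [AddCommGroup X] [Module Tᵐᵒᵖ X] [AddCommGroup Y] [Module Tᵐᵒᵖ Y] (f : X →ₗ[Tᵐᵒᵖ] Y)
    (M : TComod T C) :
    tensorMap f (mapTComod F M) ≫ upsilon F Y M = upsilon F X M ≫ F.map (tensorMap f M) :=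
  (upsilonNat F M).naturality (ModuleCat.ofHom f)

/-- The isomorphism `M ≅ T ⊗_T M`. -/
instance (M : TComod T C) : IsIso (tensorMk (1 : Tᵐᵒᵖ) M) := by
  refine ⟨tensorHom (liftₗ (A := T) (fun (t : Tᵐᵒᵖ) (m : M) => unop t • m)
    (fun t t' m => add_smul (unop t) (unop t') m) (fun t m m' => smul_add _ m m')
    (fun t s m => mul_smul (unop t) s m) (fun a t m => smul_comm (unop t) a m))
    (fun t m => (M.coact_smul (unop t) m).symm),
    RComod.hom_ext fun m => one_smul T m, tensorComod_hom_ext fun t => RComod.hom_ext fun m => ?_⟩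
  change tmul T (1 : Tᵐᵒᵖ) (unop t • m) = tmul T t m
  rw [← smul_tmul, op_unop, smul_eq_mul, mul_one]

/-- The starting point of every propagation argument. Precomposed with F(M) ≅ T ⊗ F(M), the morphism
Υ becomes F of the isomorphism M ≅ T ⊗ M. Here `Tᵐᵒᵖ` over itself is T as a right T-module. -/
theorem isIso_upsilonNat_self (F : RComod C ⥤ RComod D) [F.Additive] [F.Linear k]
    (M : TComod T C) : IsIso ((upsilonNat F M).app (ModuleCat.of Tᵐᵒᵖ Tᵐᵒᵖ)) := by
  have e : tensorMk (1 : Tᵐᵒᵖ) (mapTComod F M) ≫ upsilon F Tᵐᵒᵖ M =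
      F.map (tensorMk (1 : Tᵐᵒᵖ) M) := RComod.hom_ext fun _ => rfl
  have : IsIso (tensorMk (1 : Tᵐᵒᵖ) (mapTComod F M) ≫ upsilon F Tᵐᵒᵖ M) := by
    rw [e]
    exact Functor.map_isIso F (tensorMk (1 : Tᵐᵒᵖ) M)
  exact IsIso.of_isIso_comp_left (tensorMk (1 : Tᵐᵒᵖ) (mapTComod F M)) (upsilon F Tᵐᵒᵖ M)

end TensorFunctor

/-! ### Propagating isomorphisms along colimits -/

section Propagation

universe v₁ v₂ v₃ u₁ u₂ u₃

variable {𝒞 : Type u₁} [Category.{v₁} 𝒞] {𝒟 : Type u₂} [Category.{v₂} 𝒟] {G G' : 𝒞 ⥤ 𝒟}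
  (α : G ⟶ G')

/-- By naturality, α at the colimit is the map induced between the two image colimits by the
isomorphisms α at the objects of the diagram. -/
theorem isIso_app_of_isColimit {J : Type u₃} [Category.{v₃} J] {K : J ⥤ 𝒞} {c : Cocone K}
    (hc : IsColimit c) [PreservesColimit K G] [PreservesColimit K G']
    (h : ∀ j, IsIso (α.app (K.obj j))) : IsIso (α.app c.pt) := by
  let β : K ⋙ G ⟶ K ⋙ G' := Functor.whiskerLeft K α
  have : ∀ j, IsIso (β.app j) := h
  have : IsIso β := NatIso.isIso_of_isIso_app β
  have e : α.app c.pt = ((isColimitOfPreserves G hc).coconePointsIsoOfNatIso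
      (isColimitOfPreserves G' hc) (asIso β)).hom := by
    refine (isColimitOfPreserves G hc).hom_ext fun j => ?_
    rw [IsColimit.comp_coconePointsIsoOfNatIso_hom]
    exact α.naturality _
  rw [e]
  infer_instance

/-- An identity 1 = Σ p_i q_i makes X a retract of a finite direct sum of the Y i; the inverse is
assembled summand by summand, without requiring biproducts to exist in either category. -/
theorem isIso_app_of_sum_eq_id [Preadditive 𝒞] [Preadditive 𝒟] [G.Additive] [G'.Additive]
    {I : Type*} (s : Finset I) {X : 𝒞} (Y : I → 𝒞) (p : ∀ i, X ⟶ Y i) (q : ∀ i, Y i ⟶ X)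
    (hpq : ∑ i ∈ s, p i ≫ q i = 𝟙 X) [∀ i, IsIso (α.app (Y i))] : IsIso (α.app X) := by
  refine ⟨∑ i ∈ s, G'.map (p i) ≫ inv (α.app (Y i)) ≫ G.map (q i), ?_, ?_⟩
  · rw [Preadditive.comp_sum, ← G.map_id, ← hpq, G.map_sum]
    refine Finset.sum_congr rfl fun i _ => ?_
    rw [← α.naturality_assoc, IsIso.hom_inv_id_assoc, G.map_comp]
  · rw [Preadditive.sum_comp, ← G'.map_id, ← hpq, G'.map_sum]
    refine Finset.sum_congr rfl fun i _ => ?_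
    rw [Category.assoc, Category.assoc, α.naturality, IsIso.inv_hom_id_assoc, G'.map_comp]

theorem isIso_app_of_retract {X Y : 𝒞} (p : X ⟶ Y) (q : Y ⟶ X) (hpq : p ≫ q = 𝟙 X)
    [IsIso (α.app Y)] : IsIso (α.app X) := by
  refine ⟨G'.map p ≫ inv (α.app Y) ≫ G.map q, ?_, ?_⟩
  · rw [← α.naturality_assoc, IsIso.hom_inv_id_assoc, ← G.map_comp, hpq, G.map_id]
  · rw [Category.assoc, Category.assoc, α.naturality, IsIso.inv_hom_id_assoc, ← G'.map_comp, hpq,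
      G'.map_id]

end Propagation

end Corings

namespace Corings

/-! ### Natural transformations between functors on modules that are isomorphisms at the ring -/

section Modules

variable {R : Type u} [Ring R]

/-- The free module `J →₀ R` is the coproduct of `J` copies of `R`. -/
noncomputable def finsuppCofan (R : Type u) [Ring R] (J : Type u) :
    Cofan fun _ : J => ModuleCat.of R R :=
  Cofan.mk (ModuleCat.of R (J →₀ R)) fun j => ModuleCat.ofHom (Finsupp.lsingle j)

/-- The universal property of `finsuppCofan`. -/
noncomputable def isColimitFinsuppCofan (R : Type u) [Ring R] (J : Type u) :
    IsColimit (finsuppCofan R J) :=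
  Cofan.IsColimit.mk _ (fun s => ModuleCat.ofHom (Finsupp.lsum ℕ fun j => (s.inj j).hom))
    (fun s j => ModuleCat.hom_ext (LinearMap.ext fun x => Finsupp.lsum_single ℕ _ j x))
    (fun s m h => ModuleCat.hom_ext (Finsupp.lhom_ext fun j x => by
      refine Eq.trans ?_ (Finsupp.lsum_single ℕ _ j x).symm
      exact congrArg (fun f => f.hom x) (h j)))

/-- `P / Q` is the direct limit of the `P / K` for the finitely generated submodules `K ≤ Q`. -/
def quotientSystem {P : Type u} [AddCommGroup P] [Module R P] (Q : Submodule R P) :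
    {K : Submodule R P // K.FG ∧ K ≤ Q} ⥤ ModuleCat.{u} R where
  obj K := ModuleCat.of R (P ⧸ K.1)
  map f := ModuleCat.ofHom (Submodule.factor (leOfHom f))
  map_id _ := ModuleCat.hom_ext (Submodule.linearMap_qext _ rfl)
  map_comp _ _ := ModuleCat.hom_ext (Submodule.linearMap_qext _ rfl)

/-- The cocone of `quotientSystem` with point `P / Q`. -/
def quotientCocone {P : Type u} [AddCommGroup P] [Module R P] (Q : Submodule R P) :
    Cocone (quotientSystem Q) where
  pt := ModuleCat.of R (P ⧸ Q)
  ι := { app := fun K => ModuleCat.ofHom (Submodule.factor K.2.2)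
         naturality := fun _ _ _ => ModuleCat.hom_ext (Submodule.linearMap_qext _ rfl) }

/-- The universal property of `quotientCocone`. -/
def isColimitQuotientCocone {P : Type u} [AddCommGroup P] [Module R P] (Q : Submodule R P) :
    IsColimit (quotientCocone Q) :=
  let bot : {K : Submodule R P // K.FG ∧ K ≤ Q} := ⟨⊥, Submodule.fg_bot, bot_le⟩
  have key : ∀ (s : Cocone (quotientSystem Q)) (K : {K : Submodule R P // K.FG ∧ K ≤ Q}) (x : P),
      (s.ι.app bot).hom (Submodule.Quotient.mk x) = (s.ι.app K).hom (Submodule.Quotient.mk x) :=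
    fun s K x => congrArg (fun f => f.hom (Submodule.Quotient.mk x))
      (s.w (homOfLE (show bot ≤ K from (bot_le : ⊥ ≤ K.1)))).symm
  -- A cocone is determined by its leg at ⊥, a map out of P. This leg kills each x ∈ Q because it
  -- factors through P modulo the span of x.
  { desc := fun s => ModuleCat.ofHom (Q.liftQ ((s.ι.app bot).hom ∘ₗ Submodule.mkQ ⊥)
      fun x hx => by
        have h := key s ⟨Submodule.span R {x}, Submodule.fg_span_singleton x,
          (Submodule.span_singleton_le_iff_mem _ _).2 hx⟩ x
        refine LinearMap.mem_ker.2 (Eq.trans h ?_)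
        rw [(Submodule.Quotient.mk_eq_zero _).2 (Submodule.mem_span_singleton_self x)]
        exact map_zero _)
    fac := fun s K => ModuleCat.hom_ext (Submodule.linearMap_qext _
      (LinearMap.ext fun x => key s K x))
    uniq := fun s m h => ModuleCat.hom_ext (Submodule.linearMap_qext _
      (LinearMap.ext fun x => congrArg (fun f => f.hom (Submodule.Quotient.mk x)) (h bot))) }

/-- `J →₀ R` is the direct limit of its submodules of functions supported in a finite set. -/
noncomputable def supportedSystem (R : Type u) [Ring R] (J : Type u) : Finset J ⥤ ModuleCat.{u} R where
  obj S := ModuleCat.of R (Finsupp.supported R R (S : Set J))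
  map f := ModuleCat.ofHom (Submodule.inclusion
    (Finsupp.supported_mono (Finset.coe_subset.2 (leOfHom f))))

/-- The cocone of `supportedSystem` with point `J →₀ R`. -/
noncomputable def supportedCocone (R : Type u) [Ring R] (J : Type u) : Cocone (supportedSystem R J) where
  pt := ModuleCat.of R (J →₀ R)
  ι := { app := fun S => ModuleCat.ofHom (Submodule.subtype _) }

theorem single_mem_supported {J : Type u} {S : Finset J} {j : J} (hj : j ∈ S) (r : R) :
    Finsupp.single j r ∈ Finsupp.supported R R (S : Set J) :=
  Finsupp.single_mem_supported R r (Finset.mem_coe.2 hj)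

/-- The inclusion of `R` at an index `j ∈ S`. -/
noncomputable def supportedSingle {J : Type u} {S : Finset J} {j : J} (hj : j ∈ S) :
    R →ₗ[R] Finsupp.supported R R (S : Set J) :=
  (Finsupp.lsingle j).codRestrict _ fun r => single_mem_supported hj r

theorem sum_supportedSingle {J : Type u} {S : Finset J} (x : Finsupp.supported R R (S : Set J)) :
    ∑ j : S, supportedSingle j.2 (x.1 j) = x := by
  classical
  refine Subtype.ext ?_
  rw [AddSubmonoidClass.coe_finsetSum]
  change ∑ j : S, Finsupp.single j.1 (x.1 j) = x.1
  rw [Finset.sum_coe_sort S fun j => Finsupp.single j (x.1 j)]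
  conv_rhs => rw [← Finsupp.sum_single x.1]
  exact (Finsupp.sum_of_support_subset _ (Finset.coe_subset.1 x.2) _
    fun _ _ => Finsupp.single_zero _).symm

theorem supported_hom_ext {J : Type u} {S : Finset J} {Z : Type*} [AddCommGroup Z] [Module R Z]
    {f g : Finsupp.supported R R (S : Set J) →ₗ[R] Z}
    (h : ∀ j (hj : j ∈ S) r, f (supportedSingle hj r) = g (supportedSingle hj r)) : f = g :=
  LinearMap.ext fun x => by
    rw [← sum_supportedSingle x, map_sum, map_sum]
    exact Finset.sum_congr rfl fun j _ => h _ _ _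

/-- The universal property of `supportedCocone`. -/
noncomputable def isColimitSupportedCocone (R : Type u) [Ring R] (J : Type u) :
    IsColimit (supportedCocone R J) where
  desc s := ModuleCat.ofHom (Finsupp.lsum ℕ fun j =>
    (s.ι.app {j}).hom ∘ₗ supportedSingle (Finset.mem_singleton_self j))
  fac s S := ModuleCat.hom_ext (supported_hom_ext fun j hj r => by
    refine (Finsupp.lsum_single ℕ _ j r).trans ?_
    exact congrArg (fun f => f.hom (supportedSingle (Finset.mem_singleton_self j) r))
      (s.w (homOfLE (show {j} ≤ S from Finset.singleton_subset_iff.2 hj))).symm)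
  uniq s m h := ModuleCat.hom_ext (Finsupp.lhom_ext fun j x => by
    refine Eq.trans ?_ (Finsupp.lsum_single ℕ _ j x).symm
    exact congrArg (fun f => f.hom (supportedSingle (Finset.mem_singleton_self j) x)) (h {j}))

universe v₁ u₁

variable {𝒟 : Type u₁} [Category.{v₁} 𝒟] {G G' : ModuleCat.{u} R ⥤ 𝒟}
  (α : G ⟶ G')

theorem isIso_app_finsupp [IsIso (α.app (ModuleCat.of R R))] (J : Type u)
    [PreservesColimitsOfShape (Discrete J) G] [PreservesColimitsOfShape (Discrete J) G'] :
    IsIso (α.app (ModuleCat.of R (J →₀ R))) :=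
  isIso_app_of_isColimit α (isColimitFinsuppCofan R J) fun _ => ‹_›

/-- A natural transformation between coproduct preserving functors that is an isomorphism at `R`
is an isomorphism at all projective modules. -/
theorem isIso_app_of_projective [IsIso (α.app (ModuleCat.of R R))]
    [∀ J : Type u, PreservesColimitsOfShape (Discrete J) G]
    [∀ J : Type u, PreservesColimitsOfShape (Discrete J) G'] (X : Type u) [AddCommGroup X]
    [Module R X] [Module.Projective R X] : IsIso (α.app (ModuleCat.of R X)) := by
  -- A projective module is a retract of the free module on its own elements.
  obtain ⟨s, hs⟩ := Module.projective_def'.1 (inferInstance : Module.Projective R X)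
  have := isIso_app_finsupp α X
  exact isIso_app_of_retract α (ModuleCat.ofHom s) (ModuleCat.ofHom (Finsupp.linearCombination R id))
    (ModuleCat.hom_ext hs)

/-- A natural transformation between colimit preserving functors that is an isomorphism at `R`
is an isomorphism. -/
theorem isIso_app_of_preservesColimits [IsIso (α.app (ModuleCat.of R R))]
    [PreservesColimitsOfSize.{u, u} G] [PreservesColimitsOfSize.{u, u} G'] (X : Type u)
    [AddCommGroup X] [Module R X] : IsIso (α.app (ModuleCat.of R X)) := by
  have := PreservesColimitsOfSize.preservesFiniteColimits.{u, u} G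
  have := PreservesColimitsOfSize.preservesFiniteColimits.{u, u} G'
  -- A free presentation exhibits X as a cokernel, that is, as the colimit of a parallel pair whose
  -- two objects are free.
  let π : ModuleCat.of R (X →₀ R) ⟶ ModuleCat.of R X :=
    ModuleCat.ofHom (Finsupp.linearCombination R id)
  have : Epi π := (ModuleCat.epi_iff_surjective π).2 (Finsupp.linearCombination_id_surjective R X)
  let σ : ModuleCat.of R ((kernel π : ModuleCat.{u} R) →₀ R) ⟶ kernel π :=
    ModuleCat.ofHom (Finsupp.linearCombination R id)
  have : Epi σ := (ModuleCat.epi_iff_surjective σ).2 (Finsupp.linearCombination_id_surjective R _)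
  refine isIso_app_of_isColimit α
    (isCokernelEpiComp (Abelian.epiIsCokernelOfKernel _ (limit.isLimit (parallelPair π 0))) σ rfl) ?_
  rintro (_ | _)
  · exact isIso_app_finsupp α _
  · exact isIso_app_finsupp α _

/-- Over a von Neumann regular ring, a natural transformation between additive functors that
preserve direct limits is an isomorphism if it is one at `R`. -/
theorem isIso_app_of_vonNeumannRegular (hR : VonNeumannRegular R)
    [Preadditive 𝒟] [IsIso (α.app (ModuleCat.of R R))] [G.Additive] [G'.Additive]
    (hG : ∀ (J : Type u) [Preorder J] [IsDirectedOrder J] [Nonempty J],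
      PreservesColimitsOfShape J G)
    (hG' : ∀ (J : Type u) [Preorder J] [IsDirectedOrder J] [Nonempty J],
      PreservesColimitsOfShape J G') (X : Type u)
    [AddCommGroup X] [Module R X] : IsIso (α.app (ModuleCat.of R X)) := by
  have hfree : IsIso (α.app (ModuleCat.of R (X →₀ R))) := by
    classical
    have := hG (Finset X)
    have := hG' (Finset X)
    -- The stages are finite free modules, so additivity handles each stage and direct limits
    -- replace coproducts.
    refine isIso_app_of_isColimit α (isColimitSupportedCocone R X) fun S => ?_
    have : ∀ _ : S, IsIso (α.app (ModuleCat.of R R)) := fun _ => ‹_›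
    refine isIso_app_of_sum_eq_id α (Finset.univ : Finset S) (fun _ => ModuleCat.of R R)
      (fun j => ModuleCat.ofHom (Finsupp.lapply j.1 ∘ₗ Submodule.subtype _))
      (fun j => ModuleCat.ofHom (supportedSingle j.2)) ?_
    refine ModuleCat.hom_ext (LinearMap.ext fun x => ?_)
    rw [ModuleCat.hom_sum, LinearMap.sum_apply]
    exact sum_supportedSingle x
  let π : (X →₀ R) →ₗ[R] X := Finsupp.linearCombination R id
  have hπ : Function.Surjective π := Finsupp.linearCombination_id_surjective R X
  let J := {K : Submodule R (X →₀ R) // K.FG ∧ K ≤ LinearMap.ker π}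
  have : Nonempty J := ⟨⟨⊥, Submodule.fg_bot, bot_le⟩⟩
  have : IsDirectedOrder J := ⟨fun K L => ⟨⟨K.1 ⊔ L.1, K.2.1.sup L.2.1, sup_le K.2.2 L.2.2⟩,
    show K.1 ≤ K.1 ⊔ L.1 from le_sup_left, show L.1 ≤ K.1 ⊔ L.1 from le_sup_right⟩⟩
  have := hG J
  have := hG' J
  have hq : IsIso (α.app (ModuleCat.of R ((X →₀ R) ⧸ LinearMap.ker π))) := by
    refine isIso_app_of_isColimit α (isColimitQuotientCocone (LinearMap.ker π)) fun K => ?_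
    -- As p projects onto K, the map 1 - p descends to a section of the quotient map by K: each
    -- stage is a retract of the free module.
    obtain ⟨p, hp, hp'⟩ := hR.exists_projection K.1 K.2.1
    refine isIso_app_of_retract α (Y := ModuleCat.of R (X →₀ R))
      (ModuleCat.ofHom (K.1.liftQ (LinearMap.id - p) fun x hx => ?_))
      (ModuleCat.ofHom K.1.mkQ) (ModuleCat.hom_ext (Submodule.linearMap_qext _
        (LinearMap.ext fun x => ?_)))
    · exact LinearMap.mem_ker.2 (sub_eq_zero.2 (hp' x hx).symm)
    · refine (Submodule.Quotient.eq _).2 ?_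
      change x - p x - x ∈ K.1
      rw [sub_sub_cancel_left]
      exact K.1.neg_mem (hp x)
  let e := (LinearMap.quotKerEquivOfSurjective π hπ).toModuleIso
  exact isIso_app_of_retract α e.inv e.hom e.inv_hom_id

end Modules

end Corings

namespace Corings

open BTensor RComod

variable {k : Type w} [CommRing k] {A : Type u} [Ring A] [Algebra k A]
  {B : Type u} [Ring B] [Algebra k B] {C : Coring k A} {D : Coring k B}
  {T : Type u} [Ring T] [Algebra k T]

/-! ### When `Υ` is an isomorphism -/

section UpsilonIso

variable (F : RComod C ⥤ RComod D) [F.Additive] [F.Linear k]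

theorem isIso_upsilon_of_preservesCoproducts (hF : PreservesCoproducts F) (M : TComod T C)
    (X : Type u) [AddCommGroup X] [Module Tᵐᵒᵖ X] [Module.Projective Tᵐᵒᵖ X] :
    IsIso (upsilon F X M) := by
  have : ∀ J : Type u, PreservesColimitsOfShape (Discrete J) F := hF
  have := isIso_upsilonNat_self F M
  exact isIso_app_of_projective (upsilonNat F M) X

theorem isIso_upsilon_of_preservesInductiveLimits (hF : PreservesInductiveLimits F)
    (M : TComod T C) (X : Type u) [AddCommGroup X] [Module Tᵐᵒᵖ X] : IsIso (upsilon F X M) := by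
  have : PreservesColimitsOfSize.{u, u} F := hF
  have := isIso_upsilonNat_self F M
  exact isIso_app_of_preservesColimits (upsilonNat F M) X

theorem isIso_upsilon_of_vonNeumannRegular (hT : VonNeumannRegular T)
    (hF : PreservesDirectLimits F) (M : TComod T C) (X : Type u) [AddCommGroup X]
    [Module Tᵐᵒᵖ X] : IsIso (upsilon F X M) := by
  have := isIso_upsilonNat_self F M
  refine isIso_app_of_vonNeumannRegular (upsilonNat F M) hT.mulOpposite
    (fun J _ _ _ => inferInstance) (fun J _ _ _ => ?_) X
  have : PreservesColimitsOfShape J F := hF J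
  infer_instance

end UpsilonIso

/-! ### Kernels of comodule morphisms -/

section PureKernels

variable {X Y Z : RComod D}

/-- If `_B D` is flat, all kernels of comodule morphisms are computed in modules. -/
theorem pureKernel_of_leftFlat (hD : LeftFlat B D) (f : X ⟶ Y) : PureKernel f where
  injective := hD _ _ _ (kerMod f).subtype_injective
  exact t ht := by
    -- Factor f as a surjection followed by an injection. Flatness removes the injection after
    -- tensoring with D, and right exactness treats the surjection.
    let i : (X ⧸ kerMod f) →ₗ[Bᵐᵒᵖ] Y := (kerMod f).liftQ (lin f) le_rfl
    have hi : Function.Injective i := LinearMap.ker_eq_bot.1 (Submodule.ker_liftQ_eq_bot' _ _ rfl)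
    have h0 : rmap D (kerMod f).mkQ t = 0 := hD _ _ i hi (by
      rw [rmap_rmap, map_zero]
      exact ht)
    obtain ⟨s, hs⟩ := exists_rmap_subtype_eq (kerMod f).mkQ_surjective t h0
    have hk : LinearMap.ker (kerMod f).mkQ ≤ kerMod f := (Submodule.ker_mkQ _).le
    refine ⟨rmap D (Submodule.inclusion hk) s, ?_⟩
    rw [rmap_rmap]
    exact hs
  injective₂ := hD _ _ (rmapₗ B D (kerMod f).subtype) (hD _ _ _ (kerMod f).subtype_injective)

/-- A kernel that splits in modules is computed in modules. -/
theorem pureKernel_of_split (f : X ⟶ Y) (p : X →ₗ[Bᵐᵒᵖ] X) (q : Y →ₗ[Bᵐᵒᵖ] X)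
    (hp : ∀ x, lin f (p x) = 0) (hpq : ∀ x, p x + q (lin f x) = x) : PureKernel f := by
  -- On the kernel p is the identity, so r is a linear retraction of the inclusion; all three
  -- conditions follow by tensoring it.
  let r : X →ₗ[Bᵐᵒᵖ] kerMod f := p.codRestrict _ hp
  have hr : r ∘ₗ (kerMod f).subtype = LinearMap.id := LinearMap.ext fun x => Subtype.ext (by
    have h := hpq x.1
    rw [LinearMap.mem_ker.1 x.2, map_zero, add_zero] at h
    exact h)
  have hr₂ : rmapₗ B D r ∘ₗ rmapₗ B D (kerMod f).subtype = LinearMap.id :=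
    LinearMap.ext fun t => by
      change rmap D r (rmap D (kerMod f).subtype t) = t
      rw [rmap_rmap, hr, map_id_id]
  refine ⟨Function.LeftInverse.injective (g := rmap D r) fun t => ?_, fun t ht =>
    ⟨rmap D r t, ?_⟩, Function.LeftInverse.injective (g := rmap D (rmapₗ B D r)) fun t => ?_⟩
  · rw [rmap_rmap, hr, map_id_id]
  · have e : p + q ∘ₗ lin f = LinearMap.id := LinearMap.ext hpq
    have h : rmap D (p + q ∘ₗ lin f) t = t := by rw [e, map_id_id]
    rw [rmap_add, ← rmap_rmap, ht, map_zero, add_zero] at h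
    rw [rmap_rmap]
    exact h
  · rw [rmap_rmap, hr₂, map_id_id]

theorem PureKernel.ι_comp {f : X ⟶ Y} (h : PureKernel f) : h.ι ≫ f = 0 :=
  RComod.hom_ext fun x => LinearMap.mem_ker.1 x.2

/-- A morphism killed by `f` factors through the kernel. -/
noncomputable def PureKernel.lift {f : X ⟶ Y} (h : PureKernel f) (g : Z ⟶ X) (w : g ≫ f = 0) :
    Z ⟶ h.comod :=
  have hg : ∀ z, lin g z ∈ kerMod f := fun z =>
    LinearMap.mem_ker.2 (congrArg (fun e : Z ⟶ Y => lin e z) w)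
  ⟨(lin g).codRestrict (kerMod f) hg, fun z => h.injective
    ((rmap_rmap (A := B) (N := D) _ (kerMod f).subtype (Z.coact z)).trans
      ((hom_comm g z).trans (h.coact_spec ⟨lin g z, hg z⟩).symm))⟩

theorem PureKernel.lift_ι {f : X ⟶ Y} (h : PureKernel f) (g : Z ⟶ X) (w : g ≫ f = 0) :
    h.lift g w ≫ h.ι = g := rfl

/-- The universal property of `h.comod`. -/
noncomputable def PureKernel.isLimit {f : X ⟶ Y} (h : PureKernel f) :
    IsLimit (KernelFork.ofι h.ι h.ι_comp) :=
  KernelFork.IsLimit.ofι _ _ (fun g w => h.lift g w) (fun g w => h.lift_ι g w)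
    fun _ _ _ hm => RComod.hom_ext fun z => h.lin_ι_injective
      (congrArg (fun e : _ ⟶ X => lin e z) hm)

end PureKernels

/-! ### The coaction as a kernel -/

section Coaction

namespace RComod

/-- The coaction `ρ_N : N → N ⊗_A C` as a morphism of comodules. -/
def coactHom (N : RComod C) : N ⟶ tensorComod N C.self := ⟨N.coact, N.coassoc⟩

theorem coactHom_naturality {N N' : RComod C} (f : N ⟶ N') :
    f ≫ N'.coactHom = N.coactHom ≫ tensorMap (lin f) C.self :=
  RComod.hom_ext fun n => (hom_comm f n).symm

/-- Coassociativity is naturality of ρ at the morphism ρ_N itself, because N ⊗ Δ is the coaction of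
N ⊗ C. -/
theorem coactHom_omega (N : RComod C) : N.coactHom ≫ C.selfLeft.omega N = 0 := by
  unfold LeftCoaction.omega
  rw [Preadditive.comp_sub, sub_eq_zero]
  exact (coactHom_naturality N.coactHom).symm

end RComod

theorem contractRight_rmap {M N : Type*} [AddCommGroup M] [Module Aᵐᵒᵖ M] [AddCommGroup N]
    [Module Aᵐᵒᵖ N] {Q : Type*} [AddCommGroup Q] [Module A Q] (e : Q →ₗ[A] A) (f : M →ₗ[Aᵐᵒᵖ] N)
    (t : BTensor A M Q) : contractRight N e (rmap Q f t) = f (contractRight M e t) := by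
  induction t using BTensor.induction_on with
  | zero => simp only [map_zero]
  | add s t hs ht => simp only [map_add, hs, ht]
  | tmul m q => exact (map_smul f _ _).symm

/-- `N ⊗_A ε : N ⊗_A C → N` as a right linear map. -/
def contractCounit (C : Coring k A) (N : Type*) [AddCommGroup N] [Module Aᵐᵒᵖ N] :
    BTensor A N C →ₗ[Aᵐᵒᵖ] N where
  toFun := contractRight N C.counitL
  map_add' := map_add _
  map_smul' a t := by
    rw [RingHom.id_apply]
    induction t using BTensor.induction_on with
    | zero => simp only [smul_zero, map_zero]
    | add s t hs ht => simp only [smul_add, map_add, hs, ht]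
    | tmul n c =>
      change op (C.counit (a • c)) • n = a • op (C.counit c) • n
      rw [map_smul, ← mul_smul, ← op_unop a, op_smul_eq_mul, op_mul]

theorem contractCounit_lmap (N : Type*) [AddCommGroup N] [Module Aᵐᵒᵖ N] (t : BTensor A N C) :
    contractRight (BTensor A N C) C.counitL (lmap N C.comulL t) = t := by
  induction t using BTensor.induction_on with
  | zero => simp only [map_zero]
  | add s t hs ht => simp only [map_add, hs, ht]
  | tmul n c =>
    rw [lmap_tmul, contractRight_rmap]
    exact congrArg (tmul A n) (C.counit_right c)

/-- The left counit law of C tensored with N, whereas `contractCounit_lmap` is the right one. It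
makes the factorization through ρ_N colinear. -/
theorem rmap_contractCounit_lmap (N : Type*) [AddCommGroup N] [Module Aᵐᵒᵖ N]
    (t : BTensor A N C) : rmap C (contractCounit C N) (lmap N C.comulL t) = t := by
  induction t using BTensor.induction_on with
  | zero => simp only [map_zero]
  | add s t hs ht => simp only [map_add, hs, ht]
  | tmul n c =>
    rw [lmap_tmul, rmap_rmap]
    conv_rhs => rw [← C.counit_left c]
    change rmap C (contractCounit C N ∘ₗ mkₗ A C n) (C.comul c) = _
    generalize C.comul c = z
    induction z using BTensor.induction_on with
    | zero => simp only [map_zero, tmul_zero]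
    | add s t hs ht => simp only [map_add, hs, ht, tmul_add]
    | tmul x y => exact smul_tmul n (C.counit x) y

/-- `ρ_N` is the kernel of `ω_{N,C}` in the category of comodules. -/
def isLimitCoactHom (N : RComod C) :
    IsLimit (KernelFork.ofι N.coactHom N.coactHom_omega) :=
  -- Contract the last factor of (ρ_N ⊗ C)(t) = (N ⊗ Δ)(t) with ε: the left side becomes ρ_N((N ⊗ ε)
  -- t), the right side t. Hence (N ⊗ ε) ∘ g is the required factorization.
  have key : ∀ {Z : RComod C} (g : Z ⟶ tensorComod N C.self), g ≫ C.selfLeft.omega N = 0 →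
      ∀ z, N.coact (contractCounit C N (lin g z)) = lin g z := fun {Z} g w z => by
    have h : lin (g ≫ C.selfLeft.omega N) z = 0 := by rw [w, lin_zero]
    rw [lin_comp, LeftCoaction.omega, lin_sub, sub_eq_zero] at h
    have h' : rmap C N.coact (lin g z) = lmap N C.comulL (lin g z) := h
    exact (contractRight_rmap C.counitL N.coact (lin g z : BTensor A N C)).symm.trans
      ((congrArg (contractRight (BTensor A N C) C.counitL) h').trans
        (contractCounit_lmap N (lin g z)))
  KernelFork.IsLimit.ofι _ _
    (fun {Z} g w => ⟨contractCounit C N ∘ₗ lin g, fun z =>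
      (rmap_rmap (A := A) (N := C) (lin g) (contractCounit C N) (Z.coact z)).symm.trans
        ((congrArg (rmap C (contractCounit C N)) (hom_comm g z)).trans
          ((rmap_contractCounit_lmap N (lin g z)).trans (key g w z).symm))⟩)
    (fun g w => RComod.hom_ext fun z => key g w z)
    (fun {Z} g w m hm => RComod.hom_ext fun z => by
      rw [← N.counit (lin m z)]
      exact congrArg (fun e : Z ⟶ _ => contractCounit C N (lin e z)) hm)

end Coaction

end Corings

namespace Corings

open BTensor RComod

variable {k : Type w} [CommRing k] {A : Type u} [Ring A] [Algebra k A]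
  {B : Type u} [Ring B] [Algebra k B] {C : Coring k A} {D : Coring k B}

/-! ### Morphisms with a split kernel -/

section SplitKernel

universe v₁ v₂ u₁ u₂

/-- The kernel of `f` is the image of an idempotent `p` with `1 - p` divisible by `f`. -/
def HasSplitKernel {𝒞 : Type u₁} [Category.{v₁} 𝒞] [Preadditive 𝒞] {X Y : 𝒞} (f : X ⟶ Y) : Prop :=
  ∃ (p : X ⟶ X) (q : Y ⟶ X), p ≫ f = 0 ∧ p + f ≫ q = 𝟙 X

variable {𝒞 : Type u₁} [Category.{v₁} 𝒞] [Preadditive 𝒞] {𝒟 : Type u₂} [Category.{v₂} 𝒟]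
  [Preadditive 𝒟]

theorem HasSplitKernel.map {X Y : 𝒞} {f : X ⟶ Y} (h : HasSplitKernel f) (F : 𝒞 ⥤ 𝒟)
    [F.Additive] : HasSplitKernel (F.map f) := by
  obtain ⟨p, q, hp, hpq⟩ := h
  exact ⟨F.map p, F.map q, by rw [← F.map_comp, hp, F.map_zero],
    by rw [← F.map_comp, ← F.map_add, hpq, F.map_id]⟩

/-- Used with a and b components of Υ, to pass from F(ω_{N,C}) to ω_{N,F(C)}. -/
theorem HasSplitKernel.of_iso {X Y X' Y' : 𝒞} {f : X ⟶ Y} {f' : X' ⟶ Y'} (h : HasSplitKernel f)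
    (a : X' ⟶ X) (b : Y' ⟶ Y) [IsIso a] [IsIso b] (w : f' ≫ b = a ≫ f) : HasSplitKernel f' := by
  obtain ⟨p, q, hp, hpq⟩ := h
  have w' : f' = a ≫ f ≫ inv b := by rw [← Category.assoc, ← w, Category.assoc, IsIso.hom_inv_id,
    Category.comp_id]
  refine ⟨a ≫ p ≫ inv a, b ≫ q ≫ inv a, ?_, ?_⟩
  · rw [w']
    simp only [Category.assoc, IsIso.inv_hom_id_assoc]
    rw [← Category.assoc p, hp, zero_comp, comp_zero]
  · rw [← Category.assoc f', w, Category.assoc, ← Preadditive.comp_add, ← Category.assoc f,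
      ← Preadditive.add_comp, hpq, Category.id_comp, IsIso.hom_inv_id]

/-- Additive functors preserve split kernels. -/
theorem HasSplitKernel.preservesLimit {X Y K : 𝒞} {f : X ⟶ Y} (h : HasSplitKernel f) (F : 𝒞 ⥤ 𝒟)
    [F.Additive] {i : K ⟶ X} {w : i ≫ f = 0} (hi : IsLimit (KernelFork.ofι i w)) :
    PreservesLimit (parallelPair f 0) F := by
  obtain ⟨p, q, hp, hpq⟩ := h
  -- Factoring p through the kernel gives a retraction r of i. The kernel property then rests on
  -- equations between p, q, i and r, all kept by F.
  obtain ⟨r, hr⟩ := KernelFork.IsLimit.lift' hi p hp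
  change r ≫ i = p at hr
  have hir : i ≫ r = 𝟙 K := Fork.IsLimit.hom_ext hi (by
    change (i ≫ r) ≫ i = 𝟙 K ≫ i
    have e : i ≫ (p + f ≫ q) = i ≫ 𝟙 X := congrArg (i ≫ ·) hpq
    rw [Preadditive.comp_add, ← Category.assoc i f, w, zero_comp, add_zero, Category.comp_id] at e
    rw [Category.assoc, hr, Category.id_comp, e])
  have hF : F.map r ≫ F.map i + F.map f ≫ F.map q = 𝟙 _ := by
    rw [← F.map_comp, ← F.map_comp, hr, ← F.map_add, hpq, F.map_id]
  refine preservesLimit_of_preserves_limit_cone hi ?_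
  refine (KernelFork.isLimitMapConeEquiv _ F).symm ?_
  refine KernelFork.IsLimit.ofι (F.map i) (by rw [← F.map_comp, w, F.map_zero])
    (fun g _ => g ≫ F.map r) (fun g hg => ?_) (fun g _ m hm => ?_)
  · change (g ≫ F.map r) ≫ F.map i = g
    have e : g ≫ (F.map r ≫ F.map i + F.map f ≫ F.map q) = g ≫ 𝟙 (F.obj X) :=
      congrArg (g ≫ ·) hF
    rw [Preadditive.comp_add, ← Category.assoc g (F.map f), hg, zero_comp, add_zero,
      Category.comp_id] at e
    rw [Category.assoc, e]
  · change m ≫ F.map i = g at hm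
    rw [← hm, Category.assoc, ← F.map_comp, hir, F.map_id, Category.comp_id]

theorem HasSplitKernel.pureKernel {X Y : RComod D} {f : X ⟶ Y} (h : HasSplitKernel f) :
    PureKernel f := by
  obtain ⟨p, q, hp, hpq⟩ := h
  exact pureKernel_of_split f (lin p) (lin q)
    (fun x => congrArg (fun e : X ⟶ Y => lin e x) hp)
    (fun x => congrArg (fun e : X ⟶ X => lin e x) hpq)

end SplitKernel

/-! ### Coseparable corings -/

section Coseparable

/-- The map `X ⊗_A π : (X ⊗_A C) ⊗_A C → X ⊗_A C` for a bimodule map `π : C ⊗_A C → C`. -/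
def tensorPi (π : BTensor A C C →ₗ[Aᵐᵒᵖ] C) (hπ : ∀ (a : A) (t : BTensor A C C), π (a • t) = a • π t)
    (X : Type u) [AddCommGroup X] [Module Aᵐᵒᵖ X] :
    BTensor A (BTensor A X C) C →ₗ[Aᵐᵒᵖ] BTensor A X C :=
  -- With `P c` = π(- ⊗ c), the map sends (x ⊗ y) ⊗ c to x ⊗ π(y ⊗ c).
  let P (c : C) : C →ₗ[A] C :=
    { toFun := fun z => π (tmul A z c)
      map_add' := fun z z' => by rw [add_tmul, map_add]
      map_smul' := fun a z => hπ a (tmul A z c) }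
  have ext : ∀ {G : Type u} [AddCommGroup G] (f g : BTensor A X C →+ G),
      (∀ x c, f (tmul A x c) = g (tmul A x c)) → ∀ z, f z = g z :=
    fun f g h z => DFunLike.congr_fun (BTensor.hom_ext h) z
  liftₗ (P := BTensor A X C) (fun (z : BTensor A X C) (c : C) => BTensor.map LinearMap.id (P c) z)
    (fun z z' c => map_add _ z z')
    (fun z c c' => ext (BTensor.map LinearMap.id (P (c + c')))
      (BTensor.map LinearMap.id (P c) + BTensor.map LinearMap.id (P c')) (fun x y => by
        change tmul A x (π (tmul A y (c + c'))) =
          tmul A x (π (tmul A y c)) + tmul A x (π (tmul A y c'))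
        rw [BTensor.tmul_add, map_add, BTensor.tmul_add]) z)
    (fun z a c => ext ((BTensor.map LinearMap.id (P c)).comp (DistribSMul.toAddMonoidHom _ (op a)))
      (BTensor.map LinearMap.id (P (a • c))) (fun x y => by
        change tmul A x (π (tmul A (op a • y) c)) = tmul A x (π (tmul A y (a • c)))
        rw [BTensor.smul_tmul]) z)
    (fun s z c => ext (BTensor.map LinearMap.id (P (s • c)))
      ((DistribSMul.toAddMonoidHom (BTensor A X C) s).comp (BTensor.map LinearMap.id (P c)))
      (fun x y => congrArg (tmul A x) (map_smul π s (tmul A y c))) z)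

/-- The morphism of comodules `X ⊗_A π`, for a bimodule map `π` that is right colinear. -/
def tensorPiHom (π : BTensor A C C →ₗ[Aᵐᵒᵖ] C)
    (hπ : ∀ (a : A) (t : BTensor A C C), π (a • t) = a • π t)
    (hr : ∀ t : BTensor A C C, rmap C π (lmap C C.comulL t) = C.comul (π t))
    (X : Type u) [AddCommGroup X] [Module Aᵐᵒᵖ X] :
    tensorComod (BTensor A X C) C.self ⟶ tensorComod X C.self :=
  tensorHom (N := tensorComod X C.self) (tensorPi π hπ X) fun z c => by
    have key : ∀ (z : BTensor A X C) (c : C),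
        rmap C (tensorPi π hπ X) (lmap (BTensor A X C) C.comulL (tmul A z c)) =
          lmap X C.comulL (tensorPi π hπ X (tmul A z c)) := fun z c => by
      induction z using BTensor.induction_on with
      | zero => simp only [zero_tmul, map_zero]
      | add s t hs ht => simp only [add_tmul, map_add, hs, ht]
      | tmul x y =>
        change _ = rmap C (mkₗ (A := A) A C x) (C.comul (π (tmul A y c)))
        rw [← hr, lmap_tmul, lmap_tmul, rmap_rmap, rmap_rmap, rmap_rmap]
        rfl
    exact (rmap_rmap (A := A) (N := C) (mkₗ (A := A) A C z) (tensorPi π hπ X)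
      (C.comul c)).symm.trans (key z c)

theorem tensorComod_hom_ext₂ {X : Type u} [AddCommGroup X] [Module Aᵐᵒᵖ X] {Z : RComod C}
    {f g : tensorComod (BTensor A X C) C.self ⟶ Z}
    (h : ∀ (x : X) (y c : C), lin f (tmul A (tmul A x y) c) = lin g (tmul A (tmul A x y) c)) :
    f = g := by
  refine tensorComod_hom_ext fun z => RComod.hom_ext fun c => ?_
  let φ (f : tensorComod (BTensor A X C) C.self ⟶ Z) : BTensor A X C →+ Z :=
    (lin f).toAddMonoidHom.comp (AddMonoidHom.mk' (fun z => tmul A z c) fun z z' => add_tmul z z' c)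
  exact DFunLike.congr_fun (BTensor.hom_ext (f := φ f) (g := φ g) fun x y => h x y c) z

/-- Over a coseparable coring, `ω_{N,C}` has a split kernel. -/
theorem Coseparable.hasSplitKernel_omega (hC : Coseparable C) (N : RComod C) :
    HasSplitKernel (C.selfLeft.omega N) := by
  obtain ⟨π, hπ, hr, hl, hs⟩ := hC
  have hN : ∀ n : N, ∀ w : BTensor A C C,
      tensorPi π hπ N (rmap C (mkₗ (A := A) A C n) w) = tmul A n (π w) := fun n w => by
    induction w using BTensor.induction_on with
    | zero => simp only [map_zero, tmul_zero]
    | add s t hs ht => simp only [map_add, tmul_add, hs, ht]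
    | tmul x y => rfl
  -- Write P for N ⊗ π, l for ρ_N ⊗ C and r for N ⊗ Δ. This is P r = 1, from π Δ = 1; `h₂` is
  -- naturality of X ⊗ π in X along ρ_N.
  have h₁ : C.selfLeft.omegaRight N ≫ tensorPiHom π hπ hr N = 𝟙 _ :=
    tensorComod_hom_ext fun n => RComod.hom_ext fun c =>
      (hN n (C.comul c)).trans (congrArg (tmul A n) (hs c))
  have h₂ : tensorMap (rmapₗ A C N.coact) C.self ≫ tensorPiHom π hπ hr (BTensor A N C) =
      tensorPiHom π hπ hr N ≫ C.selfLeft.omegaLeft N :=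
    tensorComod_hom_ext₂ fun _ _ _ => rfl
  -- Left colinearity of π, tensored with N.
  have h₃ : tensorMap (lmapₗ N C.comulL fun a c => map_smul C.comul a c) C.self ≫
      tensorPiHom π hπ hr (BTensor A N C) = tensorPiHom π hπ hr N ≫ C.selfLeft.omegaRight N :=
    tensorComod_hom_ext₂ fun n x c => by
      change tensorPi π hπ (BTensor A N C) (tmul A (rmap C (mkₗ (A := A) A C n) (C.comul x)) c) =
        rmap C (mkₗ (A := A) A C n) (C.comul (π (tmul A x c)))
      rw [← hl]
      generalize C.comul x = w
      induction w using BTensor.induction_on with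
      | zero => simp only [map_zero, zero_tmul]
      | add s t hs ht => simp only [map_add, add_tmul, hs, ht]
      | tmul x y => rfl
  have h₄ : C.selfLeft.omegaLeft N ≫ tensorMap (rmapₗ A C N.coact) C.self =
      C.selfLeft.omegaLeft N ≫ tensorMap (lmapₗ N C.comulL fun a c => map_smul C.comul a c)
        C.self := by
    have e : rmapₗ A C N.coact ∘ₗ N.coact =
        lmapₗ N C.comulL (fun a c => map_smul C.comul a c) ∘ₗ N.coact := LinearMap.ext N.coassoc
    refine RComod.hom_ext fun t => ?_
    exact (rmap_rmap (A := A) (N := C) N.coact (rmapₗ A C N.coact) t).trans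
      ((congrArg (fun f => rmap C f t) e).trans (rmap_rmap (A := A) (N := C) N.coact _ t).symm)
  -- Take p = P l and q = -P. Then p + qω = P l - P(l - r) = P r = 1. By `h₂` and `h₃`, ω p is N ⊗ C
  -- ⊗ π applied to the difference of the two composites in `h₄`, which coassociativity of N makes
  -- equal.
  refine ⟨C.selfLeft.omegaLeft N ≫ tensorPiHom π hπ hr N, -tensorPiHom π hπ hr N, ?_, ?_⟩
  · unfold LeftCoaction.omega
    rw [Preadditive.comp_sub, Category.assoc, Category.assoc, ← h₂, ← h₃, ← Category.assoc,
      ← Category.assoc, h₄, sub_self]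
  · unfold LeftCoaction.omega
    rw [Preadditive.comp_neg, Preadditive.sub_comp, h₁, neg_sub, add_sub_cancel]

end Coseparable

/-! ### The bicomodule `F(C)` -/

section Bicomodule

/-- The morphism `ε ⊗_A M : C ⊗_A M → A ⊗_A M = M`. -/
def counitHom (M : TComod A D) (C : Coring k A) : tensorComod C M ⟶ M.toRComod :=
  tensorHom
    (liftₗ (A := A) (fun (c : C) (m : M) => C.counit c • m)
      (fun c c' m => by rw [map_add, add_smul])
      (fun c m m' => smul_add _ m m')
      (fun c a m => by rw [map_smul, op_smul_eq_mul, mul_smul])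
      (fun b c m => smul_comm _ b m))
    fun c m => (M.coact_smul (C.counit c) m).symm

/-- Applied with u and u' components of Υ, l the coaction of F(C) and d = F(Δ): it moves a
computation after λ to one after F(Δ). -/
theorem comp_comp_of_square {𝒞 : Type*} [Category 𝒞] {P X Y X' Y' : 𝒞} {l : P ⟶ X} {u : X ⟶ X'}
    {d : P ⟶ X'} (hl : l ≫ u = d) {f : X ⟶ Y} {u' : Y ⟶ Y'} {f' : X' ⟶ Y'}
    (hf : f ≫ u' = u ≫ f') : (l ≫ f) ≫ u' = d ≫ f' := by
  rw [Category.assoc, hf, ← Category.assoc, hl]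

variable (F : RComod C ⥤ RComod D) [F.Additive] [F.Linear k]

/-- On c ⊗ y the right side is F applied to multiplication by ε(c), evaluated at y, which is the
action of ε(c) on F(C) by definition. -/
theorem counitHom_mapTComod :
    counitHom (mapTComod F C.self) C = upsilon F C C.self ≫ F.map (counitHom C.self C) :=
  tensorComod_hom_ext fun c =>
    (F.map_comp (tensorMk c C.self) (counitHom C.self C)).trans rfl

variable [IsIso (upsilon F C C.self)]

/-- The coaction `Υ⁻¹ ∘ F(Δ)` of `F(C)`. -/
noncomputable def mapCoact : (mapTComod F C.self).toRComod ⟶ tensorComod C (mapTComod F C.self) :=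
  F.map C.selfLeft.hom ≫ inv (upsilon F C C.self)

theorem mapCoact_upsilon : mapCoact F ≫ upsilon F C C.self = F.map C.selfLeft.hom := by
  unfold mapCoact
  erw [Category.assoc, IsIso.inv_hom_id, Category.comp_id]

/-- Left linearity of λ: after composing with the monomorphism Υ it becomes F of the left linearity
of Δ. -/
theorem leftMul_mapCoact (a : A) : (mapTComod F C.self).leftMul a ≫ mapCoact F =
    mapCoact F ≫ tensorMap (DistribSMul.toLinearMap Aᵐᵒᵖ C a) (mapTComod F C.self) := by
  rw [← cancel_mono (upsilon F C C.self), Category.assoc, Category.assoc, upsilon_naturality,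
    ← Category.assoc (mapCoact F), mapCoact_upsilon]
  refine Eq.trans ?_ (F.map_comp _ _)
  refine (F.map_comp (C.self.leftMul a) C.selfLeft.hom).symm.trans (congrArg F.map ?_)
  exact RComod.hom_ext fun c => C.comul_smul a c

/-- The right linear map underlying `mapCoact`. -/
noncomputable def mapCoactₗ : mapTComod F C.self →ₗ[Bᵐᵒᵖ] BTensor A C (mapTComod F C.self) :=
  lin (mapCoact F)

theorem mapCoactₗ_smul (a : A) (y : mapTComod F C.self) :
    mapCoactₗ F (a • y) = a • mapCoactₗ F y :=
  congrArg (fun e : (mapTComod F C.self).toRComod ⟶ tensorComod C (mapTComod F C.self) => lin e y)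
    (leftMul_mapCoact F a)

/-- The coaction of `F(C)` as a left linear map. -/
noncomputable def mapCoactL : mapTComod F C.self →ₗ[A] BTensor A C (mapTComod F C.self) where
  toFun := mapCoactₗ F
  map_add' := map_add (mapCoactₗ F)
  map_smul' := mapCoactₗ_smul F

/-- The morphism `N ⊗_A (Υ⁻¹ ∘ F(Δ))`. -/
noncomputable def tensorMapCoact (N : RComod C) : tensorComod N (mapTComod F C.self) ⟶
    tensorComod (BTensor A N C) (mapTComod F C.self) :=
  tensorHom (lmapₗ (A := A) (S := A) (R := B) (Q := mapTComod F C.self) N (mapCoactL F)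
      fun b y => map_smul (mapCoactₗ F) b y)
    fun n y => hom_comm (mapCoact F ≫ tensorMap (mkₗ (A := A) A C n) _) y

/-- Restricted to n ⊗ -, both composites reduce to λ followed by n ⊗ -, so naturality of Υ along n ⊗
- : C → N ⊗ C and Υ λ = F(Δ) suffice. -/
theorem tensorMapCoact_upsilon (N : RComod C) :
    tensorMapCoact F N ≫ upsilon F (BTensor A N C) C.self =
      upsilon F N C.self ≫ F.map (C.selfLeft.omegaRight N) := by
  refine tensorComod_hom_ext fun n => ?_
  have e₁ : tensorMk n (mapTComod F C.self) ≫ tensorMapCoact F N =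
    mapCoact F ≫ tensorMap (mkₗ (A := A) A C n) _ := rfl
  have e₂ : tensorMk n (mapTComod F C.self) ≫ upsilon F N C.self = F.map (tensorMk n C.self) := rfl
  have e₃ : tensorMk n C.self ≫ C.selfLeft.omegaRight N =
    C.selfLeft.hom ≫ tensorMap (mkₗ (A := A) A C n) C.self := rfl
  rw [← Category.assoc, e₁, Category.assoc, upsilon_naturality, ← Category.assoc,
    mapCoact_upsilon, ← Category.assoc, e₂]
  refine (F.map_comp _ _).symm.trans (Eq.trans ?_ (F.map_comp _ _))
  rw [e₃]

/-- The `(C, D)`-bicomodule `F(C)`. -/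
noncomputable def mapLeftCoaction [IsIso (upsilon F (BTensor A C C) C.self)] :
    LeftCoaction C (mapTComod F C.self) where
  coact := mapCoactₗ F
  comm := hom_comm (mapCoact F)
  coact_smul := mapCoactₗ_smul F
  coassoc y := by
    -- Composed with Υ_{C⊗C,C}, the two sides become F of the two sides of coassociativity of Δ.
    have h : mapCoact F ≫ tensorMap C.comul (mapTComod F C.self) =
        mapCoact F ≫ tensorMapCoact F C.self.toRComod := by
      have e : C.selfLeft.hom ≫ tensorMap C.comul C.self =
          C.selfLeft.hom ≫ C.selfLeft.omegaRight C.self.toRComod :=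
        RComod.hom_ext fun c => C.coassoc c
      have e₁ := comp_comp_of_square (mapCoact_upsilon F) (upsilon_naturality F C.comul C.self)
      have e₂ := comp_comp_of_square (mapCoact_upsilon F) (tensorMapCoact_upsilon F C.self.toRComod)
      refine (cancel_mono (upsilon F (BTensor A C C) C.self)).1 (e₁.trans (Eq.trans ?_ e₂.symm))
      exact (F.map_comp _ _).symm.trans ((congrArg F.map e).trans (F.map_comp _ _))
    exact congrArg (fun e : (mapTComod F C.self).toRComod ⟶
      tensorComod (BTensor A C C) (mapTComod F C.self) => lin e y) h
  counit y := by
    have e : C.selfLeft.hom ≫ counitHom C.self C = 𝟙 _ := RComod.hom_ext fun c => C.counit_left c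
    have h : mapCoact F ≫ counitHom (mapTComod F C.self) C = 𝟙 (mapTComod F C.self).toRComod :=
      (congrArg (mapCoact F ≫ ·) (counitHom_mapTComod F)).trans
        ((Category.assoc _ _ _).symm.trans
          ((congrArg (· ≫ F.map (counitHom C.self C)) (mapCoact_upsilon F)).trans
            ((F.map_comp _ _).symm.trans ((congrArg F.map e).trans (F.map_id _)))))
    exact congrArg (fun e : (mapTComod F C.self).toRComod ⟶ (mapTComod F C.self).toRComod =>
      lin e y) h

theorem omega_upsilon [IsIso (upsilon F (BTensor A C C) C.self)] (N : RComod C) :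
    (mapLeftCoaction F).omega N ≫ upsilon F (BTensor A N C) C.self =
      upsilon F N C.self ≫ F.map (C.selfLeft.omega N) := by
  unfold LeftCoaction.omega
  rw [F.map_sub, Preadditive.comp_sub, Preadditive.sub_comp]
  exact congrArg₂ (· - ·) (upsilon_naturality F N.coact C.self) (tensorMapCoact_upsilon F N)

end Bicomodule

end Corings

namespace Corings

open BTensor RComod

variable {k : Type w} [CommRing k] {A : Type u} [Ring A] [Algebra k A]
  {B : Type u} [Ring B] [Algebra k B] {C : Coring k A} {D : Coring k B}

/-! ### The isomorphism with the cotensor functor -/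

section Iso

variable (F : RComod C ⥤ RComod D) [F.Additive] [F.Linear k]

/-- F(ρ_N) is a kernel of F(ω_{N,C}), and Υ identifies the latter with ω_{N,F(C)}; uniqueness of
kernels gives the isomorphism F(N) ≅ N □_C F(C). -/
theorem isoCotensor_of_pureKernel (hΥ : UpsilonIso F)
    [IsIso (upsilon F C C.self)] [IsIso (upsilon F (BTensor A C C) C.self)]
    (hL : ∀ N : RComod C, PreservesLimit (parallelPair (C.selfLeft.omega N) 0) F)
    (h : ∀ N : RComod C, PureKernel ((mapLeftCoaction F).omega N)) : IsoCotensor F := by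
  refine ⟨mapLeftCoaction F, inferInstance, mapCoact_upsilon F, h, ?_⟩
  have := fun N => (hΥ N).1
  have := fun N => (hΥ N).2
  have hlim : ∀ N : RComod C, IsLimit ((KernelFork.ofι N.coactHom N.coactHom_omega).map F) := fun N =>
    have := hL N
    KernelFork.mapIsLimit _ (isLimitCoactHom N) F
  have hw : ∀ N : RComod C, (F.map N.coactHom ≫ inv (upsilon F N C.self)) ≫
      (mapLeftCoaction F).omega N = 0 := fun N => by
    rw [← cancel_mono (upsilon F (BTensor A N C) C.self), Category.assoc, omega_upsilon,
      Category.assoc, IsIso.inv_hom_id_assoc, ← F.map_comp, N.coactHom_omega, F.map_zero, zero_comp]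
  -- The comparison is characterized by `ha`; its inverse comes from the universal property of
  -- F(ρ_N).
  let a (N : RComod C) : F.obj N ⟶ (h N).comod := (h N).lift _ (hw N)
  have ha : ∀ N, a N ≫ (h N).ι ≫ upsilon F N C.self = F.map N.coactHom := fun N => by
    rw [← Category.assoc, (h N).lift_ι, Category.assoc, IsIso.inv_hom_id, Category.comp_id]
  have hι : ∀ N, Mono ((h N).ι) := fun N => mono_of_isLimit_fork (h N).isLimit
  have hF : ∀ N : RComod C, Mono (F.map N.coactHom) := fun N => mono_of_isLimit_fork (hlim N)
  have hiso : ∀ N, IsIso (a N) := fun N => by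
    obtain ⟨b, hb⟩ : ∃ b : (h N).comod ⟶ F.obj N,
        b ≫ F.map N.coactHom = (h N).ι ≫ upsilon F N C.self := by
      obtain ⟨b, hb⟩ := KernelFork.IsLimit.lift' (hlim N) ((h N).ι ≫ upsilon F N C.self) (by
        rw [Category.assoc, ← omega_upsilon, ← Category.assoc, (h N).ι_comp, zero_comp])
      exact ⟨b, hb⟩
    refine ⟨b, ?_, ?_⟩
    · rw [← cancel_mono (F.map N.coactHom), Category.assoc, hb, ha, Category.id_comp]
    · rw [← cancel_mono ((h N).ι), ← cancel_mono (upsilon F N C.self), Category.assoc,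
        Category.assoc, ha, hb, Category.id_comp]
  refine ⟨NatIso.ofComponents (fun N => @asIso _ _ _ _ (a N) (hiso N)) fun {N N'} f => ?_⟩
  -- Naturality is tested after the monomorphism into F(N' ⊗ C), where it reduces to naturality of ρ
  -- and of Υ.
  have e₁ : (F.map f ≫ a N') ≫ (h N').ι ≫ upsilon F N' C.self =
      F.map N.coactHom ≫ F.map (tensorMap (lin f) C.self) := by
    rw [Category.assoc, ha, ← F.map_comp, ← F.map_comp, coactHom_naturality]
  have e₂ : (a N ≫ (h N).ι ≫ tensorMap (lin f) (mapTComod F C.self)) ≫ upsilon F N' C.self =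
      F.map N.coactHom ≫ F.map (tensorMap (lin f) C.self) := by
    rw [Category.assoc, Category.assoc, upsilon_naturality, ← ha N, Category.assoc, Category.assoc]
  refine (cancel_mono ((h N').ι ≫ upsilon F N' C.self)).1 (e₁.trans (e₂.symm.trans ?_))
  exact Category.assoc (a N ≫ (cotensor (mapLeftCoaction F) h).map f) ((h N').ι) _

/-- In the coseparable case one splitting of ω_{N,C} serves twice: F preserves its kernel, and its
image under F, carried along Υ, makes the kernel of ω_{N,F(C)} pure. -/
theorem IsoCotensor.of_upsilonIso
    (hF : FlatPreservesKernels F ∨ CoseparableAbelian C D) (hΥ : UpsilonIso F) :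
    IsoCotensor F := by
  have h₁ : IsIso (upsilon F C C.self) := (hΥ C.self.toRComod).1
  have h₂ : IsIso (upsilon F (BTensor A C C) C.self) := (hΥ C.self.toRComod).2
  rcases hF with ⟨hD, hF⟩ | ⟨hC, -⟩
  · exact isoCotensor_of_pureKernel F hΥ hF fun N => pureKernel_of_leftFlat hD _
  · have := fun N => (hΥ N).1
    have := fun N => (hΥ N).2
    exact isoCotensor_of_pureKernel F hΥ
      (fun N => (hC.hasSplitKernel_omega N).preservesLimit F (isLimitCoactHom N))
      fun N => (((hC.hasSplitKernel_omega N).map F).of_iso (upsilon F N C.self)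
        (upsilon F (BTensor A N C) C.self) (omega_upsilon F N)).pureKernel

end Iso

end Corings

/-! ### The main theorem and the sufficient conditions for its hypotheses -/

theorem theorem3 {k : Type w} [CommRing k] {A B : Type u} [Ring A] [Algebra k A] [Ring B]
    [Algebra k B] (C : Coring k A) (D : Coring k B) (F : RComod C ⥤ RComod D)
    [F.Additive] [F.Linear k] :
    ((FlatPreservesKernels F ∨ CoseparableAbelian C D) →
      ((Module.Projective Aᵐᵒᵖ C ∧ PreservesCoproducts F ∧ UpsilonIso F) ∨
        (RightFlat A C ∧ PreservesDirectLimits F ∧ UpsilonIso F) ∨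
        PreservesInductiveLimits F) →
      IsoCotensor F) ∧
    (IsSemisimpleRing A → PreservesCoproducts F → Module.Projective Aᵐᵒᵖ C ∧ UpsilonIso F) ∧
    (VonNeumannRegular A → PreservesDirectLimits F → RightFlat A C ∧ UpsilonIso F) ∧
    (F.IsLeftAdjoint → PreservesInductiveLimits F) := by 
  refine ⟨fun hF h => ?_, fun hA hF => ?_, fun hA hF => ?_, fun hF => ?_⟩
  · refine IsoCotensor.of_upsilonIso F hF ?_
    rcases h with ⟨_, _, h⟩ | ⟨_, _, h⟩ | h
    · exact h
    · exact h
    · exact fun N => ⟨isIso_upsilon_of_preservesInductiveLimits F h _ _,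
        isIso_upsilon_of_preservesInductiveLimits F h _ _⟩
  -- Semisimplicity passes to the opposite ring, so all right modules are projective, including C, N
  -- and N ⊗ C.
  · have : ∀ (X : Type u) [AddCommGroup X] [Module Aᵐᵒᵖ X], Module.Projective Aᵐᵒᵖ X :=
      fun _ _ _ => Module.projective_of_isSemisimpleRing _ _
    exact ⟨this C, fun N => ⟨isIso_upsilon_of_preservesCoproducts F hF _ _,
      isIso_upsilon_of_preservesCoproducts F hF _ _⟩⟩
  · exact ⟨hA.rightFlat C, fun N => ⟨isIso_upsilon_of_vonNeumannRegular F hA hF _ _,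
      isIso_upsilon_of_vonNeumannRegular F hA hF _ _⟩⟩
  · exact (Adjunction.ofIsLeftAdjoint F).leftAdjoint_preservesColimits
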